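/- Let $N$ be a connected, simply connected nilpotent Lie group, let $(\varphi_t)_{t\in\mathbb R}$ be a smooth one-parameter group of automorphisms of $N$ that is expanding ($\varphi_{-t}(g)\to 1$ as $t\to\infty$ for every $g\in N$), and let $m\ge 2$ be an integer. Let $G_\varphi=N\rtimes_\varphi\mathbb R$ carry a left invariant Riemannian metric for which, at the identity, $\partial/\partial t$ is a unit vector orthogonal to $T_1N$ (so that the lines $t\mapsto(g,t)$ are unit speed geodesics), with height function $h_\varphi(g,t)=t$. Let $T_{m+1}$ be the $(m+1)$-valent tree with edges of length $1$, oriented so that each vertex has $m$ incoming edges and one outgoing edge, with height function $h_m$ which increases at unit speed along the orientation and is integral at vertices. The space $X=X_{N,\varphi,m}$ is $\{(x,y)\in G_\varphi\times T_{m+1} : h_\varphi(x)=h_m(y)\}$ with the path metric induced from the $\ell^2$ product metric, rescaled by $1/\sqrt2$, and height function $h(x,y)=h_\varphi(x)=h_m(y)$. A vertical geodesic of $X$ is a geodesic line $\xi:\mathbb R\to X$ with $h(\xi_t)=t$ for all $t$. The parabolic visual boundary $\partial X\setminus\{\infty\}$ is identified with the set of vertical geodesics ($\xi_t$ goes down to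 the boundary point $\xi$ as $t\to-\infty$ and up to $\infty$ as $t\to\infty$), and it carries the parabolic visual metric $d_\infty(\xi,\eta)=e^{t_0}$ for $\xi\neq\eta$, where $t_0$ is the smallest $t$ with $d_X(\xi_t,\eta_t)=1$. Let $\mathbb Q_m$ be the $m$-adics with the standard metric $|x-y|_m$ ($=m^{-k}$, where $k$ is the index of the first $m$-adic digit at which $x\ne y$ differ), identified as usual with the set of coherently oriented lines $\ell_x:\mathbb R\to T_{m+1}$ parametrized by height, so that $\ell_x,\ell_y$ meet at height $t_0$ with $m^{t_0}=|x-y|_m$. Let $d_\varphi(g,g')=m^{t_0}$ for $g\ne g'$ in $N$, where $t_0$ is the smallest $t$ with $d_{G_\varphi}((g,t),(g',t))=1$, and let $d_{\varphi,m}$ be the maximum of $d_\varphi$ and $|\cdot|_m$ on $N\times\mathbb Q_m$. A quasi-isometry $f:X\to X$ is height-respecting if there is a constant $A$ such that $f$ maps each level set of $h$ to within Hausdorff distance $A$ of a level set of $h$, and there are constants $a,C$ with $h(x)+a-C\le h(f(x))\le h(x)+a+C$ for all $x\in X$. **Proposition.** The assignment $(g,x)\mapsto \big(t\mapsto((g,t),\ell_x(t))\big)$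 is a bijection of $N\times\mathbb Q_m$ onto $\partial X\setminus\{\infty\}$. Every height-respecting quasi-isometry $f$ of $X$ induces a bilipschitz bijection of $\partial X\setminus\{\infty\}\simeq N\times\mathbb Q_m$: there is a unique map $F:\partial X\setminus\{\infty\}\to\partial X\setminus\{\infty\}$ such that for every vertical geodesic $\xi$, $f$ maps each of the two rays $\{\xi_t: t\le 0\}$ and $\{\xi_t:t\ge 0\}$ to within finite Hausdorff distance of the ray $\{F(\xi)_t:t\le 0\}$, respectively $\{F(\xi)_t:t\ge 0\}$. This $F$ is a bijection, it is bilipschitz with respect to $d_\infty$, and the corresponding map of $N\times\mathbb Q_m$ is bilipschitz with respect to $d_{\varphi,m}$. -/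

import Mathlib

open Set Filter Topology Manifold
open scoped ENNReal NNReal ContDiff

namespace Millefeuille

noncomputable section

/-! ### Generalities on metric spaces -/

section Metric

/-- The length (path) extended distance of a metric space: the infimum of the lengths of the
continuous paths between two points. -/
def pathEDist {A : Type*} [PseudoEMetricSpace A] (p q : A) : ℝ≥0∞ :=
  ⨅ γ : Path p q, eVariationOn γ univ

theorem pathEDist_self {A : Type*} [PseudoEMetricSpace A] (p : A) : pathEDist p p = 0 := by
  refine le_antisymm (iInf_le_of_le (Path.refl p) ?_) bot_le
  refine (eVariationOn.constant_on ?_).le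
  rintro _ ⟨s, -, rfl⟩ _ ⟨t, -, rfl⟩
  simp

theorem pathEDist_le_comm {A : Type*} [PseudoEMetricSpace A] (p q : A) :
    pathEDist p q ≤ pathEDist q p := by
  refine le_iInf fun γ => iInf_le_of_le γ.symm ?_
  have : (γ.symm : unitInterval → A) = γ ∘ unitInterval.symm := by
    ext t; simp [Path.symm]
  rw [this]
  exact eVariationOn.comp_le_of_antitoneOn _ _
    (fun a _ b _ h => unitInterval.symm_le_symm.2 h) (mapsTo_univ _ _)

theorem pathEDist_comm {A : Type*} [PseudoEMetricSpace A] (p q : A) :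
    pathEDist p q = pathEDist q p :=
  le_antisymm (pathEDist_le_comm p q) (pathEDist_le_comm q p)

theorem pathEDist_triangle {A : Type*} [PseudoEMetricSpace A] (p q r : A) :
    pathEDist p r ≤ pathEDist p q + pathEDist q r := by
  unfold pathEDist
  simp only [ENNReal.iInf_add, ENNReal.add_iInf]
  refine le_iInf fun γ' => le_iInf fun γ => iInf_le_of_le (γ.trans γ') ?_
  have h2 : (univ : Set unitInterval) =
      {t : unitInterval | (t : ℝ) ≤ 1 / 2} ∪ {t : unitInterval | 1 / 2 ≤ (t : ℝ)} := by
    ext t; simpa using le_total (t : ℝ) 2⁻¹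
  have hx : (1 / 2 : ℝ) ∈ unitInterval := by constructor <;> norm_num
  have hs : IsGreatest {t : unitInterval | (t : ℝ) ≤ 1 / 2} ⟨1 / 2, hx⟩ :=
    ⟨le_refl (1 / 2 : ℝ), fun t ht => ht⟩
  have ht : IsLeast {t : unitInterval | 1 / 2 ≤ (t : ℝ)} ⟨1 / 2, hx⟩ :=
    ⟨le_refl (1 / 2 : ℝ), fun t ht => ht⟩
  have h01 : (0 : ℝ) ≤ 1 := zero_le_one
  conv_lhs => rw [h2]
  rw [eVariationOn.union _ hs ht]
  refine add_le_add ?_ ?_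
  · have h : EqOn (γ.trans γ') (γ ∘ fun t : unitInterval => projIcc 0 1 h01 (2 * t))
        {t | (t : ℝ) ≤ 1 / 2} := by
      intro t ht
      simp only [Path.trans_apply, mem_ofPred_eq] at ht ⊢
      rw [dif_pos ht]
      simp only [Function.comp_apply]
      rw [projIcc_of_mem]
    rw [eVariationOn.congr h]
    refine eVariationOn.comp_le_of_monotoneOn _ _ (fun a _ b _ hab => monotone_projIcc _ ?_)
      (mapsTo_univ _ _)
    have : (a : ℝ) ≤ b := hab
    linarith
  · have h : EqOn (γ.trans γ') (γ' ∘ fun t : unitInterval => projIcc 0 1 h01 (2 * t - 1))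
        {t | 1 / 2 ≤ (t : ℝ)} := by
      intro t ht
      simp only [Path.trans_apply, mem_ofPred_eq] at ht ⊢
      simp only [Function.comp_apply]
      split_ifs with h3
      · have h4 : (t : ℝ) = 1 / 2 := le_antisymm h3 ht
        have h5 : projIcc 0 1 h01 (2 * (t : ℝ) - 1) = 0 := by
          rw [projIcc_of_le_left]
          · rfl
          · rw [h4]; norm_num
        rw [h5, γ'.source]
        have h6 : (⟨2 * (t : ℝ), (unitInterval.mul_pos_mem_iff zero_lt_two).2 ⟨t.2.1, h3⟩⟩ :
            unitInterval) = 1 := by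
          ext; simp [h4]
        rw [h6, γ.target]
      · rw [projIcc_of_mem]
    rw [eVariationOn.congr h]
    refine eVariationOn.comp_le_of_monotoneOn _ _ (fun a _ b _ hab => monotone_projIcc _ ?_)
      (mapsTo_univ _ _)
    have : (a : ℝ) ≤ b := hab
    linarith

/-- A quasi-isometry: a quasi-isometric embedding with coarsely dense image. -/
def IsQuasiIsometry {A : Type*} [PseudoEMetricSpace A] (f : A → A) : Prop :=
  ∃ K C : ℝ≥0, 0 < K ∧
    (∀ x y, edist x y / K ≤ edist (f x) (f y) + C ∧ edist (f x) (f y) ≤ K * edist x y + C) ∧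
    ∀ z, ∃ x, edist (f x) z ≤ C

/-- A self-map `f` is height-respecting for the height function `h` if it maps every level set of
`h` to within uniform Hausdorff distance of a level set of `h`, and if the map induced on heights
is at bounded distance from a translation. -/
def IsHeightRespecting {A : Type*} [PseudoEMetricSpace A] (h : A → ℝ) (f : A → A) : Prop :=
  (∃ D : ℝ≥0, ∀ t, ∃ t', Metric.hausdorffEDist (f '' (h ⁻¹' {t})) (h ⁻¹' {t'}) ≤ D) ∧
    ∃ a C : ℝ, ∀ x, h x + a - C ≤ h (f x) ∧ h (f x) ≤ h x + a + C

/-- Bilipschitz maps, for a distance given by a real-valued function. -/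
def IsBilipschitz {B : Type*} (d : B → B → ℝ) (F : B → B) : Prop :=
  ∃ a b : ℝ, 0 < a ∧ 0 < b ∧ ∀ ξ η, a * d ξ η ≤ d (F ξ) (F η) ∧ d (F ξ) (F η) ≤ b * d ξ η

/-- `b ^ t₀`, where `t₀` is the (smallest) parameter at which `γ` and `γ'` are at distance `1`.
It is `sInf ∅ = 0` when `γ = γ'`. -/
def parabolicDist {A : Type*} [PseudoEMetricSpace A] (b : ℝ) (γ γ' : ℝ → A) : ℝ :=
  sInf ((fun t : ℝ => b ^ t) '' {t : ℝ | edist (γ t) (γ' t) = 1})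

end Metric

/-! ### The negatively curved homogeneous space -/

section Heintze

variable {E : Type*} [NormedAddCommGroup E] [NormedSpace ℝ E]
  {N : Type*} [TopologicalSpace N] [ChartedSpace E N] [Group N]

/-- A smooth one-parameter group of automorphisms of `N`. -/
def IsSmoothFlow (E : Type*) [NormedAddCommGroup E] [NormedSpace ℝ E]
    {N : Type*} [TopologicalSpace N] [ChartedSpace E N] [Group N]
    (φ : Multiplicative ℝ →* MulAut N) : Prop :=
  ContMDiff (𝓘(ℝ, ℝ).prod 𝓘(ℝ, E)) 𝓘(ℝ, E) ∞
    (fun p : ℝ × N => φ (Multiplicative.ofAdd p.1) p.2)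

/-- A one-parameter group of automorphisms is expanding if `φ_{-t}(g) → 1` as `t → ∞`. -/
def IsExpanding {N : Type*} [TopologicalSpace N] [Group N]
    (φ : Multiplicative ℝ →* MulAut N) : Prop :=
  ∀ g : N, Tendsto (fun t : ℝ => φ (Multiplicative.ofAdd (-t)) g) atTop (𝓝 1)

/-- Left translation by `p⁻¹` in the group `N ⋊[φ] ℝ`, in the coordinates `N × ℝ`. -/
def leftTranslate (φ : Multiplicative ℝ →* MulAut N) (p q : N × ℝ) : N × ℝ :=
  let r : N ⋊[φ] Multiplicative ℝ :=
    (⟨p.1, Multiplicative.ofAdd p.2⟩ : N ⋊[φ] Multiplicative ℝ)⁻¹ * ⟨q.1, Multiplicative.ofAdd q.2⟩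
  (r.left, r.right.toAdd)

/-- The derivative of `leftTranslate φ p` at `p`, which carries the tangent space at `p` to the tangent
space `T₁N ⊕ ℝ` at the identity `leftTranslate φ p p = (1, 0)`. -/
def toIdentity (φ : Multiplicative ℝ →* MulAut N) (p : N × ℝ) :
    TangentSpace (𝓘(ℝ, E).prod 𝓘(ℝ, ℝ)) p →L[ℝ] GroupLieAlgebra 𝓘(ℝ, E) N × ℝ :=
  mfderiv (𝓘(ℝ, E).prod 𝓘(ℝ, ℝ)) (𝓘(ℝ, E).prod 𝓘(ℝ, ℝ)) (leftTranslate φ p) p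

/-- The left invariant Riemannian norm on `N ⋊[φ] ℝ` which at the identity is given by the inner
product `ip` on `T₁N` and makes `∂/∂t` a unit vector orthogonal to `T₁N`. -/
def tangentNorm (φ : Multiplicative ℝ →* MulAut N)
    (ip : InnerProductSpace.Core ℝ (GroupLieAlgebra 𝓘(ℝ, E) N)) (p : N × ℝ)
    (w : TangentSpace (𝓘(ℝ, E).prod 𝓘(ℝ, ℝ)) p) : ℝ :=
  √(ip.inner (toIdentity φ p w).1 (toIdentity φ p w).1 + (toIdentity φ p w).2 ^ 2)

/-- The tangent spaces of `N × ℝ` with the left invariant norm. -/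
@[reducible]
def tangentENorm (φ : Multiplicative ℝ →* MulAut N)
    (ip : InnerProductSpace.Core ℝ (GroupLieAlgebra 𝓘(ℝ, E) N)) (p : N × ℝ) :
    ENorm (TangentSpace (𝓘(ℝ, E).prod 𝓘(ℝ, ℝ)) p) :=
  ⟨fun w => ENNReal.ofReal (tangentNorm φ ip p w)⟩

theorem tangentNorm_smul (φ : Multiplicative ℝ →* MulAut N)
    (ip : InnerProductSpace.Core ℝ (GroupLieAlgebra 𝓘(ℝ, E) N)) (p : N × ℝ) (r : ℝ)
    (w : TangentSpace (𝓘(ℝ, E).prod 𝓘(ℝ, ℝ)) p) :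
    tangentNorm φ ip p (r • w) = |r| * tangentNorm φ ip p w := by
  have h2 : ∀ x y : GroupLieAlgebra 𝓘(ℝ, E) N, ip.inner (r • x) y = r * ip.inner x y :=
    fun x y => by simpa using ip.smul_left x y r
  have h3 : ∀ x y : GroupLieAlgebra 𝓘(ℝ, E) N, ip.inner x y = ip.inner y x :=
    fun x y => by simpa using ip.conj_inner_symm y x
  have h4 : ∀ v : GroupLieAlgebra 𝓘(ℝ, E) N × ℝ,
      ip.inner (r • v).1 (r • v).1 + (r • v).2 ^ 2 =
        r ^ 2 * (ip.inner v.1 v.1 + v.2 ^ 2) := by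
    intro v
    rw [Prod.smul_fst, Prod.smul_snd, h2, h3, h2, smul_eq_mul]
    ring
  unfold tangentNorm
  rw [map_smul, h4, Real.sqrt_mul (sq_nonneg r), Real.sqrt_sq_eq_abs]

theorem tangentENorm_smul (φ : Multiplicative ℝ →* MulAut N)
    (ip : InnerProductSpace.Core ℝ (GroupLieAlgebra 𝓘(ℝ, E) N)) (p : N × ℝ) :
    @ENormSMulClass ℝ (TangentSpace (𝓘(ℝ, E).prod 𝓘(ℝ, ℝ)) p) _ (tangentENorm φ ip p) _ := by
  let _ := tangentENorm φ ip p
  refine ⟨fun r w => ?_⟩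
  change ENNReal.ofReal _ = _ * ENNReal.ofReal _
  rw [tangentNorm_smul, ENNReal.ofReal_mul (abs_nonneg r), Real.enorm_eq_ofReal_abs]

/-- The group `G_φ = N ⋊[φ] ℝ`, to be endowed with its left invariant Riemannian distance. -/
structure Heintze (φ : Multiplicative ℝ →* MulAut N)
    (ip : InnerProductSpace.Core ℝ (GroupLieAlgebra 𝓘(ℝ, E) N)) where
  toGroup : N ⋊[φ] Multiplicative ℝ

variable {φ : Multiplicative ℝ →* MulAut N}
  {ip : InnerProductSpace.Core ℝ (GroupLieAlgebra 𝓘(ℝ, E) N)}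

namespace Heintze

/-- The point `(g, t)` of `G_φ`, that is, the vertical geodesic `t ↦ (g, t)` of `G_φ`. -/
def vertical (ip : InnerProductSpace.Core ℝ (GroupLieAlgebra 𝓘(ℝ, E) N)) (g : N) (t : ℝ) :
    Heintze φ ip :=
  ⟨⟨g, Multiplicative.ofAdd t⟩⟩

/-- The coordinates `(g, t)` of a point of `G_φ`. -/
def coords (p : Heintze φ ip) : N × ℝ :=
  (p.toGroup.left, p.toGroup.right.toAdd)

/-- The height function `(g, t) ↦ t` on `G_φ`. -/
def height (p : Heintze φ ip) : ℝ := p.coords.2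

/-- The left invariant Riemannian distance. -/
instance : PseudoEMetricSpace (Heintze φ ip) :=
  letI : ∀ p : N × ℝ, ENorm (TangentSpace (𝓘(ℝ, E).prod 𝓘(ℝ, ℝ)) p) := tangentENorm φ ip
  haveI : ∀ p : N × ℝ, ENormSMulClass ℝ (TangentSpace (𝓘(ℝ, E).prod 𝓘(ℝ, ℝ)) p) :=
    tangentENorm_smul φ ip
  { edist := fun p q => riemannianEDist (𝓘(ℝ, E).prod 𝓘(ℝ, ℝ)) p.coords q.coords
    edist_self := fun _ => riemannianEDist_self
    edist_comm := fun _ _ => riemannianEDist_comm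
    edist_triangle := fun _ _ _ => riemannianEDist_triangle }

end Heintze

end Heintze

/-! ### The `m`-adics and the regular tree -/

section Tree

/-- The `m`-adic numbers `∑ i, digit i * m ^ i` with digits `0, …, m - 1`, all but finitely many of
the digits of negative index being zero. -/
@[ext]
structure MAdic (m : ℕ) [NeZero m] where
  digit : ℤ → Fin m
  eventually_zero : ∃ k, ∀ i < k, digit i = 0

/-- The standard metric on the `m`-adics: `|x - y| = m ^ (-k)`, where `k` is the index of the first
digit at which `x` and `y` differ. -/
def MAdic.dist {m : ℕ} [NeZero m] (x y : MAdic m) : ℝ :=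
  sInf ((fun k : ℤ => (m : ℝ) ^ (-k)) '' {k | ∀ i < k, x.digit i = y.digit i})

/-- The points of the (geometric realization of the) regular tree `T_{m+1}` of valence `m + 1`
with edges of length one, oriented so that each vertex has one outgoing edge (going up) and `m`
incoming edges. The vertices of height `k : ℤ` are the classes of `m`-adics modulo `m ^ (-k)`, that
is, the families of digits of index `< -k` (extended by zero). The outgoing edge of such a vertex
goes up to the vertex of height `k + 1` obtained by erasing the digit of index `-k - 1`.
A point of height `t` is a point of the edge which goes up from its lower end at height `⌊t⌋`, and
it is given by the digits of this lower end. -/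
@[ext]
structure TreePoint (m : ℕ) [NeZero m] where
  height : ℝ
  digit : ℤ → Fin m
  eventually_zero : ∃ k, ∀ i < k, digit i = 0
  digit_eq_zero : ∀ i, -⌊height⌋ ≤ i → digit i = 0

namespace TreePoint

variable {m : ℕ} [NeZero m]

/-- The heights at which the upward rays issued from `p` and `q` have met. -/
def meetSet (p q : TreePoint m) : Set ℝ :=
  {t | p.height ≤ t ∧ q.height ≤ t ∧ ∀ i < -⌊t⌋, p.digit i = q.digit i}

/-- The height at which the upward rays issued from `p` and `q` meet. -/
def meetHeight (p q : TreePoint m) : ℝ := sInf (meetSet p q)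

theorem meetSet_comm (p q : TreePoint m) : meetSet p q = meetSet q p := by
  ext t
  exact ⟨fun h => ⟨h.2.1, h.1, fun i hi => (h.2.2 i hi).symm⟩,
    fun h => ⟨h.2.1, h.1, fun i hi => (h.2.2 i hi).symm⟩⟩

theorem meetSet_nonempty (p q : TreePoint m) : (meetSet p q).Nonempty := by
  obtain ⟨k, hk⟩ := p.eventually_zero
  obtain ⟨l, hl⟩ := q.eventually_zero
  refine ⟨max (max p.height q.height) (max (-k : ℤ) (-l : ℤ)), by simp, by simp, fun i hi => ?_⟩
  have h1 : -k ≤ ⌊max (max p.height q.height) (max ((-k : ℤ) : ℝ) ((-l : ℤ) : ℝ))⌋ :=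
    Int.le_floor.2 (by simp)
  have h2 : -l ≤ ⌊max (max p.height q.height) (max ((-k : ℤ) : ℝ) ((-l : ℤ) : ℝ))⌋ :=
    Int.le_floor.2 (by simp)
  rw [hk i (by omega), hl i (by omega)]

theorem meetSet_bddBelow (p q : TreePoint m) : BddBelow (meetSet p q) :=
  ⟨p.height, fun _ h => h.1⟩

theorem meetHeight_mem (p q : TreePoint m) : meetHeight p q ∈ meetSet p q := by
  refine ⟨le_csInf (meetSet_nonempty p q) fun t h => h.1,
    le_csInf (meetSet_nonempty p q) fun t h => h.2.1, ?_⟩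
  obtain ⟨t, ht, htlt⟩ := exists_lt_of_csInf_lt (meetSet_nonempty p q)
    (Int.lt_floor_add_one (meetHeight p q))
  have h1 : ⌊t⌋ < ⌊meetHeight p q⌋ + 1 := by
    rw [Int.floor_lt]; exact_mod_cast htlt
  intro i hi
  exact ht.2.2 i (by omega)

theorem meetHeight_le {p q : TreePoint m} {t : ℝ} (h : t ∈ meetSet p q) : meetHeight p q ≤ t :=
  csInf_le (meetSet_bddBelow p q) h

theorem meetHeight_self (p : TreePoint m) : meetHeight p p = p.height :=
  le_antisymm (meetHeight_le ⟨le_rfl, le_rfl, fun _ _ => rfl⟩) (meetHeight_mem p p).1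

theorem meetHeight_le_max (p q r : TreePoint m) :
    meetHeight p r ≤ max (meetHeight p q) (meetHeight q r) := by
  have h1 := meetHeight_mem p q
  have h2 := meetHeight_mem q r
  refine meetHeight_le ⟨h1.1.trans (le_max_left _ _), h2.2.1.trans (le_max_right _ _),
    fun i hi => ?_⟩
  have h3 := Int.floor_le_floor (le_max_left (meetHeight p q) (meetHeight q r))
  have h4 := Int.floor_le_floor (le_max_right (meetHeight p q) (meetHeight q r))
  rw [h1.2.2 i (by omega), h2.2.2 i (by omega)]

/-- The path distance of the tree: the geodesic from `p` to `q` goes up from `p` to the meeting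
point of the upward rays, and then down to `q`. -/
instance : MetricSpace (TreePoint m) where
  dist p q := (meetHeight p q - p.height) + (meetHeight p q - q.height)
  dist_self p := by simp [meetHeight_self]
  dist_comm p q := by
    rw [meetHeight, meetHeight, meetSet_comm p q]
    ring
  dist_triangle p q r := by
    have h1 := meetHeight_mem p q
    have h2 := meetHeight_mem q r
    have h3 := meetHeight_le_max p q r
    rcases le_max_iff.1 h3 with h | h
    · linarith [h1.1, h1.2.1, h2.1, h2.2.1]
    · linarith [h1.1, h1.2.1, h2.1, h2.2.1]
  eq_of_dist_eq_zero := by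
    intro p q h
    have h1 := meetHeight_mem p q
    have h2 : (meetHeight p q - p.height) + (meetHeight p q - q.height) = 0 := h
    have h3 : meetHeight p q = p.height := by linarith [h1.1, h1.2.1]
    have h4 : meetHeight p q = q.height := by linarith [h1.1, h1.2.1]
    refine TreePoint.ext (h3.symm.trans h4) (funext fun i => ?_)
    by_cases hi : i < -⌊meetHeight p q⌋
    · exact h1.2.2 i hi
    · rw [p.digit_eq_zero i (by rw [← h3]; omega), q.digit_eq_zero i (by rw [← h4]; omega)]

/-- The point at height `t` on the coherently oriented line of the tree which corresponds to the
`m`-adic number `x`. -/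
def ofMAdic (x : MAdic m) (t : ℝ) : TreePoint m where
  height := t
  digit i := if i < -⌊t⌋ then x.digit i else 0
  eventually_zero := by
    obtain ⟨k, hk⟩ := x.eventually_zero
    exact ⟨k, fun i hi => by simp [hk i hi]⟩
  digit_eq_zero i hi := by simp [not_lt.2 hi]

end TreePoint

end Tree

/-! ### The millefeuille space -/

section Space

variable {E : Type*} [NormedAddCommGroup E] [NormedSpace ℝ E]
  {N : Type*} [TopologicalSpace N] [ChartedSpace E N] [Group N]
  (φ : Multiplicative ℝ →* MulAut N)
  (ip : InnerProductSpace.Core ℝ (GroupLieAlgebra 𝓘(ℝ, E) N))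
  (m : ℕ) [NeZero m]

/-- The horocyclic product, as a subset of the Riemannian (`ℓ²`) product `G_φ × T_{m+1}`. -/
def horocyclic : Set (WithLp 2 (Heintze φ ip × TreePoint m)) :=
  {p | p.fst.height = p.snd.height}

/-- The millefeuille space `X_{N,φ,m}`. -/
structure Space where
  toProd : horocyclic φ ip m

variable {φ ip m}

namespace Space

/-- The component in `G_φ` of a point of `X_{N,φ,m}`. -/
def fst (p : Space φ ip m) : Heintze φ ip := p.toProd.1.fst

/-- The component in `T_{m+1}` of a point of `X_{N,φ,m}`. -/
def snd (p : Space φ ip m) : TreePoint m := p.toProd.1.snd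

/-- The height function. -/
def height (p : Space φ ip m) : ℝ := p.fst.height

/-- The path distance induced from the product, rescaled by `1 / √2`. -/
instance : PseudoEMetricSpace (Space φ ip m) where
  edist p q := ENNReal.ofReal (1 / √2) * pathEDist p.toProd q.toProd
  edist_self p := by simp [pathEDist_self]
  edist_comm p q := by rw [pathEDist_comm]
  edist_triangle p q r := by
    rw [← mul_add]
    exact mul_le_mul_right (pathEDist_triangle _ _ _) _

/-- The point at height `t` on the vertical geodesic of `X_{N,φ,m}` given by `g : N` and the
`m`-adic number `x`. -/
def vertical (ξ : N × MAdic m) (t : ℝ) : Space φ ip m :=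
  ⟨⟨WithLp.toLp 2 (Heintze.vertical ip ξ.1 t, TreePoint.ofMAdic ξ.2 t), rfl⟩⟩

end Space

variable (φ ip m)

/-- The parabolic visual boundary `∂X - {∞}` of `X = X_{N,φ,m}`, that is, the set of vertical
geodesics of `X`: the geodesic lines parametrized by height. The line `ξ` is the geodesic which goes
from its end point `ξ ∈ ∂X - {∞}` (as `t → -∞`) up to the point `∞` (as `t → ∞`). -/
structure Boundary where
  line : ℝ → Space φ ip m
  isometry : Isometry line
  height_line : ∀ t, (line t).height = t

variable {φ ip m}

/-- The parabolic visual metric on `∂X - {∞}`: it is `e ^ t₀`, where `t₀` is the height at which the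
two vertical geodesics are at distance `1`. -/
def Boundary.dist (ξ η : Boundary φ ip m) : ℝ :=
  parabolicDist (Real.exp 1) ξ.line η.line

/-- The boundary map `F` is induced by `f : X → X`: the geodesic ray going down to `ξ` is mapped by
`f` to within finite Hausdorff distance of the ray going down to `F ξ`, and the complementary ray
going up to `∞` to within finite Hausdorff distance of a ray going up to `∞`. -/
def Induces (f : Space φ ip m → Space φ ip m) (F : Boundary φ ip m → Boundary φ ip m) : Prop :=
  ∀ ξ, Metric.hausdorffEDist (f '' (ξ.line '' Iic 0)) ((F ξ).line '' Iic 0) ≠ ⊤ ∧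
    Metric.hausdorffEDist (f '' (ξ.line '' Ici 0)) ((F ξ).line '' Ici 0) ≠ ⊤

/-- The metric `d_φ` on `N`: the parabolic visual metric of `G_φ`, with base `m` so that it matches
the standard metric of the `m`-adics (base `m` amounts to a rescaling of `φ`). -/
def distN (φ : Multiplicative ℝ →* MulAut N)
    (ip : InnerProductSpace.Core ℝ (GroupLieAlgebra 𝓘(ℝ, E) N)) (m : ℕ) (g g' : N) : ℝ :=
  parabolicDist (A := Heintze φ ip) m (Heintze.vertical ip g) (Heintze.vertical ip g')

/-- The metric `d_{φ,m}` on `N × ℚ_m`, the maximum of the metrics of the factors. -/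
def distProd (φ : Multiplicative ℝ →* MulAut N)
    (ip : InnerProductSpace.Core ℝ (GroupLieAlgebra 𝓘(ℝ, E) N)) (ξ η : N × MAdic m) : ℝ :=
  max (distN φ ip m ξ.1 η.1) (MAdic.dist ξ.2 η.2)

end Space

end

end Millefeuille

/-! Left invariance puts all of the geometry of `G_φ` at the identity: the lines over `g` and `g'`
are, at height `t`, as far apart as `(1, 0)` and `(φ_{-t}(g⁻¹g'), 0)`. Bounded distance at height
`t` therefore means that `φ_{-t}(g⁻¹g')` lies in a fixed compact set, and since `φ_{-s} → 1`
uniformly on compact sets (a Baire category argument), lines which are `R`-close at some height are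
`ε`-close from a uniformly bounded height above it onwards. In the tree, lines which are `R`-close
at height `t` coincide from height `t + R` on. Hence the vertical lines of `X` form an
`IsContractingFamily`: two of them that remain at bounded distance downwards are equal, and the
height at which two distinct ones are at distance `1` is determined up to a bounded error by any
height at which their distance is bounded above and below.

The second ingredient is shadowing. Points of `X` near the heights `n * S` (`n : ℤ`) with bounded
jumps stay within bounded distance of one vertical line (`Space.exists_shadow_vertical`). In `N`
this comes from a compact `Q` with `φ_{-S}(Q · Q) ⊆ Q` (`IsExpanding.exists_absorbing`), in `ℚ_m`
from reading off digits. Applied to the image under `f` of a line `ξ`, it gives a line `F ξ` with `f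
(ξ_t)` within `B` of `(F ξ)_t` for all `t`; the translation of heights only enlarges the constant.
Applied to coarse preimages of the points of a line, it gives surjectivity.

At each height the distance of `F ξ` and `F η` is thus coarsely Lipschitz equivalent to that of `ξ`
and `η`, so the heights at which these distances equal `1` differ by a bounded amount, and their
exponentials by a bounded factor. The same argument covers `d_∞` and `d_{φ,m}`, both of which are
comparable to a power whose exponent is such a height.

That every vertical geodesic has the form `((g, t), ℓ_x(t))` is an equality case: the `ℓ²` estimate
forces each component to move exactly as far as the height, and in `G_φ` this forces `g` to be
constant (`eq_one_of_edist_le`), by testing against functions `c * height + s * bump` rather than by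
studying geodesics. -/

set_option linter.unusedSectionVars false

namespace Millefeuille

noncomputable section

/-! ### The one-parameter group, and left translations in coordinates. -/

section Flow

variable {N : Type*} [Group N] (φ : Multiplicative ℝ →* MulAut N)

/-- The automorphism of `N` at time `t` of a one-parameter group of automorphisms. -/
def flow (t : ℝ) : N ≃* N := φ (Multiplicative.ofAdd t)

theorem flow_zero (g : N) : flow φ 0 g = g := by
  simp [flow]

theorem flow_flow (s t : ℝ) (g : N) : flow φ s (flow φ t g) = flow φ (s + t) g := by
  simp [flow, ofAdd_add]

theorem flow_flow_neg (t : ℝ) (g : N) : flow φ t (flow φ (-t) g) = g := by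
  rw [flow_flow, add_neg_cancel, flow_zero]

theorem flow_neg_flow (t : ℝ) (g : N) : flow φ (-t) (flow φ t g) = g := by
  rw [flow_flow, neg_add_cancel, flow_zero]

theorem leftTranslate_eq (p q : N × ℝ) :
    leftTranslate φ p q = (flow φ (-p.2) (p.1⁻¹ * q.1), q.2 - p.2) := by
  simp [leftTranslate, flow, SemidirectProduct.mul_left, ofAdd_neg, sub_eq_neg_add]

/-- This is `(p⁻¹q)⁻¹(p⁻¹r) = q⁻¹r`. It yields both the invariance of the norm and the inverse of a
translation. -/
theorem leftTranslate_leftTranslate (p q r : N × ℝ) :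
    leftTranslate φ (leftTranslate φ p q) (leftTranslate φ p r) = leftTranslate φ q r := by
  simp only [leftTranslate_eq]
  refine Prod.ext ?_ ?_
  · rw [← map_inv, ← map_mul, flow_flow]
    simp only
    congr 1
    · ring_nf
    · group
  · simp

theorem leftTranslate_self (p : N × ℝ) : leftTranslate φ p p = (1, 0) := by
  simp [leftTranslate_eq]

theorem leftTranslate_one (q : N × ℝ) : leftTranslate φ (1, 0) q = q := by
  simp [leftTranslate_eq, flow_zero]

end Flow

/-! ### Derivatives of left translations. -/

section Smooth

variable {E : Type*} [NormedAddCommGroup E] [NormedSpace ℝ E]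
  {N : Type*} [TopologicalSpace N] [ChartedSpace E N] [Group N]
  {φ : Multiplicative ℝ →* MulAut N}

theorem IsSmoothFlow.contMDiff_flow {M F : Type*} [NormedAddCommGroup F] [NormedSpace ℝ F] {H : Type*}
    [TopologicalSpace H] {I : ModelWithCorners ℝ F H} [TopologicalSpace M] [ChartedSpace H M]
    (hφ : IsSmoothFlow E φ) {a : M → ℝ} {b : M → N} (ha : ContMDiff I 𝓘(ℝ, ℝ) ∞ a)
    (hb : ContMDiff I 𝓘(ℝ, E) ∞ b) :
    ContMDiff I 𝓘(ℝ, E) ∞ (fun x => flow φ (a x) (b x)) :=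
  hφ.comp (ha.prodMk hb)

theorem IsSmoothFlow.continuous_flow {M : Type*} [TopologicalSpace M]
    (hφ : IsSmoothFlow E φ) {a : M → ℝ} {b : M → N} (ha : Continuous a)
    (hb : Continuous b) : Continuous (fun x => flow φ (a x) (b x)) :=
  hφ.continuous.comp (ha.prodMk hb)

variable [LieGroup 𝓘(ℝ, E) ∞ N]

/-- A left translation is the product of a map of `N` and a shift of `ℝ`, so its derivative is block
diagonal. -/
theorem hasMFDerivAt_leftTranslate (hφ : IsSmoothFlow E φ) (p : N × ℝ) :
    HasMFDerivAt (𝓘(ℝ, E).prod 𝓘(ℝ, ℝ)) (𝓘(ℝ, E).prod 𝓘(ℝ, ℝ)) (leftTranslate φ p) p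
      ((mfderiv 𝓘(ℝ, E) 𝓘(ℝ, E) (fun x => flow φ (-p.2) (p.1⁻¹ * x)) p.1).prodMap
        (ContinuousLinearMap.id ℝ ℝ)) := by
  have h : leftTranslate φ p =
      Prod.map (fun x => flow φ (-p.2) (p.1⁻¹ * x)) (fun s : ℝ => s - p.2) := by
    ext q <;> simp [leftTranslate_eq]
  have h1 : HasMFDerivAt 𝓘(ℝ, E) 𝓘(ℝ, E) (fun x => flow φ (-p.2) (p.1⁻¹ * x)) p.1
      (mfderiv 𝓘(ℝ, E) 𝓘(ℝ, E) (fun x => flow φ (-p.2) (p.1⁻¹ * x)) p.1) :=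
    ((hφ.contMDiff_flow contMDiff_const contMDiff_mul_left).mdifferentiable
      (by simp) p.1).hasMFDerivAt
  have h2 : HasMFDerivAt 𝓘(ℝ, ℝ) 𝓘(ℝ, ℝ) (fun s : ℝ => s - p.2) p.2
      (ContinuousLinearMap.id ℝ ℝ) :=
    ((hasFDerivAt_id p.2).sub_const p.2).hasMFDerivAt
  rw [h]
  have h3 := h1.prodMap h2
  rw [h2.mfderiv] at h3
  exact h3

theorem toIdentity_apply (hφ : IsSmoothFlow E φ) (p : N × ℝ)
    (w : TangentSpace (𝓘(ℝ, E).prod 𝓘(ℝ, ℝ)) p) :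
    toIdentity φ p w =
      (mfderiv 𝓘(ℝ, E) 𝓘(ℝ, E) (fun x => flow φ (-p.2) (p.1⁻¹ * x)) p.1 w.1, w.2) := by
  rw [toIdentity, (hasMFDerivAt_leftTranslate hφ p).mfderiv]
  rfl

end Smooth

end

/-! ### Lengths of paths, and lower bounds for them by test functions. -/

noncomputable section

/-- The derivative of a real function on a manifold. -/
def realDeriv {F : Type*} [NormedAddCommGroup F] [NormedSpace ℝ F] {K : Type*} [TopologicalSpace K]
    (I : ModelWithCorners ℝ F K) {M : Type*} [TopologicalSpace M] [ChartedSpace K M] (H : M → ℝ)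
    (p : M) (w : TangentSpace I p) : ℝ :=
  mfderiv I 𝓘(ℝ, ℝ) H p w

section Length

variable {E : Type*} [NormedAddCommGroup E] [NormedSpace ℝ E]
  {N : Type*} [TopologicalSpace N] [ChartedSpace E N] [Group N]
  {φ : Multiplicative ℝ →* MulAut N}
  {ip : InnerProductSpace.Core ℝ (GroupLieAlgebra 𝓘(ℝ, E) N)}

variable (φ ip) in
/-- The length of a path in `N ⋊[φ] ℝ` for the left invariant Riemannian metric. -/
def len (γ : ℝ → N × ℝ) (a b : ℝ) : ℝ≥0∞ :=
  letI : ∀ p : N × ℝ, ENorm (TangentSpace (𝓘(ℝ, E).prod 𝓘(ℝ, ℝ)) p) := tangentENorm φ ip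
  pathELength (𝓘(ℝ, E).prod 𝓘(ℝ, ℝ)) γ a b

theorem len_eq (γ : ℝ → N × ℝ) (a b : ℝ) :
    len φ ip γ a b = ∫⁻ t in Icc a b, ENNReal.ofReal (tangentNorm φ ip (γ t)
      (mfderivWithin 𝓘(ℝ, ℝ) (𝓘(ℝ, E).prod 𝓘(ℝ, ℝ)) γ (Icc a b) t 1)) := by
  let _ : ∀ p : N × ℝ, ENorm (TangentSpace (𝓘(ℝ, E).prod 𝓘(ℝ, ℝ)) p) := tangentENorm φ ip
  rw [len, pathELength_eq_lintegral_mfderivWithin_Icc]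
  rfl

theorem len_add {γ : ℝ → N × ℝ} {a b c : ℝ} (h : a ≤ b) (h' : b ≤ c) :
    len φ ip γ a b + len φ ip γ b c = len φ ip γ a c := by
  let _ : ∀ p : N × ℝ, ENorm (TangentSpace (𝓘(ℝ, E).prod 𝓘(ℝ, ℝ)) p) := tangentENorm φ ip
  exact pathELength_add h h'

variable (φ ip) in
/-- The point of `G_φ` with given coordinates. -/
def Heintze.ofCoords (p : N × ℝ) : Heintze φ ip := Heintze.vertical ip p.1 p.2

theorem Heintze.ofCoords_coords (p : Heintze φ ip) : Heintze.ofCoords φ ip p.coords = p := rfl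

theorem Heintze.coords_vertical (g : N) (t : ℝ) :
    (Heintze.vertical (φ := φ) ip g t).coords = (g, t) := rfl

theorem edist_ofCoords_le_len {γ : ℝ → N × ℝ} {a b : ℝ} (hab : a ≤ b)
    (hγ : ContMDiffOn 𝓘(ℝ, ℝ) (𝓘(ℝ, E).prod 𝓘(ℝ, ℝ)) 1 γ (Icc a b)) :
    edist (Heintze.ofCoords φ ip (γ a)) (Heintze.ofCoords φ ip (γ b)) ≤ len φ ip γ a b := by
  let _ : ∀ p : N × ℝ, ENorm (TangentSpace (𝓘(ℝ, E).prod 𝓘(ℝ, ℝ)) p) := tangentENorm φ ip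
  have : ∀ p : N × ℝ, ENormSMulClass ℝ (TangentSpace (𝓘(ℝ, E).prod 𝓘(ℝ, ℝ)) p) :=
    tangentENorm_smul φ ip
  exact riemannianEDist_le_pathELength hγ rfl rfl hab

theorem exists_len_lt {p q : Heintze φ ip} {r : ℝ≥0∞} (h : edist p q < r) :
    ∃ γ : ℝ → N × ℝ, γ 0 = p.coords ∧ γ 1 = q.coords ∧
      ContMDiffOn 𝓘(ℝ, ℝ) (𝓘(ℝ, E).prod 𝓘(ℝ, ℝ)) 1 γ (Icc 0 1) ∧ len φ ip γ 0 1 < r := by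
  let _ : ∀ p : N × ℝ, ENorm (TangentSpace (𝓘(ℝ, E).prod 𝓘(ℝ, ℝ)) p) := tangentENorm φ ip
  have : ∀ p : N × ℝ, ENormSMulClass ℝ (TangentSpace (𝓘(ℝ, E).prod 𝓘(ℝ, ℝ)) p) :=
    tangentENorm_smul φ ip
  exact exists_lt_of_riemannianEDist_lt h

/-- The derivative of `H ∘ γ` is bounded by the speed of `γ`. The gradient bound is required only
along `γ`, so that `H` may be `1`-Lipschitz merely at bounded heights. -/
theorem ofReal_abs_sub_le_len {γ : ℝ → N × ℝ} {a b : ℝ} (hab : a ≤ b)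
    (hγ : ContMDiffOn 𝓘(ℝ, ℝ) (𝓘(ℝ, E).prod 𝓘(ℝ, ℝ)) 1 γ (Icc a b)) {H : N × ℝ → ℝ}
    (hH : ContMDiff (𝓘(ℝ, E).prod 𝓘(ℝ, ℝ)) 𝓘(ℝ, ℝ) 1 H)
    (hle : ∀ t ∈ Icc a b, ∀ w : TangentSpace (𝓘(ℝ, E).prod 𝓘(ℝ, ℝ)) (γ t),
      |realDeriv (𝓘(ℝ, E).prod 𝓘(ℝ, ℝ)) H (γ t) w| ≤ tangentNorm φ ip (γ t) w) :
    ENNReal.ofReal |H (γ b) - H (γ a)| ≤ len φ ip γ a b := by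
  rcases hab.eq_or_lt with rfl | hlt
  · simp
  have h1 : ContDiffOn ℝ 1 (H ∘ γ) (Icc a b) :=
    contMDiffOn_iff_contDiffOn.1 (hH.comp_contMDiffOn hγ)
  have h2 := enorm_sub_le_lintegral_derivWithin_Icc_of_contDiffOn_Icc h1 hab
  rw [Real.enorm_eq_ofReal_abs] at h2
  refine h2.trans ?_
  rw [len_eq]
  refine MeasureTheory.setLIntegral_mono' measurableSet_Icc fun t ht => ?_
  have h3 : mfderivWithin 𝓘(ℝ, ℝ) 𝓘(ℝ, ℝ) (H ∘ γ) (Icc a b) t =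
      (mfderiv (𝓘(ℝ, E).prod 𝓘(ℝ, ℝ)) 𝓘(ℝ, ℝ) H (γ t)).comp
        (mfderivWithin 𝓘(ℝ, ℝ) (𝓘(ℝ, E).prod 𝓘(ℝ, ℝ)) γ (Icc a b) t) := by
    refine mfderiv_comp_mfderivWithin t (hH.mdifferentiable one_ne_zero _)
      (hγ.mdifferentiableOn one_ne_zero t ht) ?_
    rw [uniqueMDiffWithinAt_iff_uniqueDiffWithinAt]
    exact uniqueDiffOn_Icc hlt _ ht
  have h4 : derivWithin (H ∘ γ) (Icc a b) t =
      realDeriv (𝓘(ℝ, E).prod 𝓘(ℝ, ℝ)) H (γ t)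
        (mfderivWithin 𝓘(ℝ, ℝ) (𝓘(ℝ, E).prod 𝓘(ℝ, ℝ)) γ (Icc a b) t 1) := by
    rw [← fderivWithin_derivWithin, ← mfderivWithin_eq_fderivWithin, h3]
    rfl
  rw [h4, Real.enorm_eq_ofReal_abs]
  exact ENNReal.ofReal_le_ofReal (hle t ht _)

end Length

end

/-! ### Left invariance of the distance; vertical lines and the height. -/

noncomputable section

section Invariance

variable {E : Type*} [NormedAddCommGroup E] [NormedSpace ℝ E]
  {N : Type*} [TopologicalSpace N] [ChartedSpace E N] [Group N] [LieGroup 𝓘(ℝ, E) ∞ N]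
  {φ : Multiplicative ℝ →* MulAut N}
  {ip : InnerProductSpace.Core ℝ (GroupLieAlgebra 𝓘(ℝ, E) N)}

theorem contMDiff_leftTranslate (hφ : IsSmoothFlow E φ) (p : N × ℝ) :
    ContMDiff (𝓘(ℝ, E).prod 𝓘(ℝ, ℝ)) (𝓘(ℝ, E).prod 𝓘(ℝ, ℝ)) ∞ (leftTranslate φ p) := by
  have h : leftTranslate φ p = fun q : N × ℝ => (flow φ (-p.2) (p.1⁻¹ * q.1), q.2 - p.2) :=
    funext fun q => leftTranslate_eq φ p q
  rw [h]
  refine ContMDiff.prodMk (hφ.contMDiff_flow contMDiff_const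
    (contMDiff_const.mul contMDiff_fst)) ?_
  exact (contDiff_id.sub contDiff_const).contMDiff.comp contMDiff_snd

theorem tangentNorm_leftTranslate (hφ : IsSmoothFlow E φ) (p q : N × ℝ)
    (w : TangentSpace (𝓘(ℝ, E).prod 𝓘(ℝ, ℝ)) q) :
    tangentNorm φ ip (leftTranslate φ p q)
      (mfderiv (𝓘(ℝ, E).prod 𝓘(ℝ, ℝ)) (𝓘(ℝ, E).prod 𝓘(ℝ, ℝ)) (leftTranslate φ p) q w) =
      tangentNorm φ ip q w := by
  have h : toIdentity φ (leftTranslate φ p q)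
      (mfderiv (𝓘(ℝ, E).prod 𝓘(ℝ, ℝ)) (𝓘(ℝ, E).prod 𝓘(ℝ, ℝ)) (leftTranslate φ p) q w) =
      toIdentity φ q w := by
    have h1 : leftTranslate φ q = leftTranslate φ (leftTranslate φ p q) ∘ leftTranslate φ p :=
      funext fun r => (leftTranslate_leftTranslate φ p q r).symm
    have h2 := mfderiv_comp q
      ((contMDiff_leftTranslate hφ (leftTranslate φ p q)).mdifferentiable (by simp) _)
      ((contMDiff_leftTranslate hφ p).mdifferentiable (by simp) q)
    rw [← h1] at h2
    exact congrArg (fun l => l w) h2.symm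
  simp only [tangentNorm, h]

theorem len_leftTranslate (hφ : IsSmoothFlow E φ) (p : N × ℝ) {γ : ℝ → N × ℝ} {a b : ℝ}
    (hγ : ContMDiffOn 𝓘(ℝ, ℝ) (𝓘(ℝ, E).prod 𝓘(ℝ, ℝ)) 1 γ (Icc a b)) :
    len φ ip (leftTranslate φ p ∘ γ) a b = len φ ip γ a b := by
  rcases lt_or_ge a b with hlt | hle
  · rw [len_eq, len_eq]
    refine MeasureTheory.setLIntegral_congr_fun measurableSet_Icc fun t ht => ?_
    have h3 := mfderiv_comp_mfderivWithin t
      ((contMDiff_leftTranslate hφ p).mdifferentiable (by simp) (γ t))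
      (hγ.mdifferentiableOn one_ne_zero t ht)
      (uniqueMDiffWithinAt_iff_uniqueDiffWithinAt.2 (uniqueDiffOn_Icc hlt _ ht))
    simp only [h3]
    congr 1
    exact tangentNorm_leftTranslate hφ p (γ t) _
  · have : ∀ γ', len φ ip γ' a b = 0 := by
      intro γ'
      rw [len_eq, ← MeasureTheory.restrict_Ioo_eq_restrict_Icc, Ioo_eq_empty hle.not_gt]
      simp
    rw [this, this]

theorem edist_leftTranslate_le (hφ : IsSmoothFlow E φ) (p : N × ℝ) (x y : N × ℝ) :
    edist (Heintze.ofCoords φ ip (leftTranslate φ p x))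
      (Heintze.ofCoords φ ip (leftTranslate φ p y)) ≤
      edist (Heintze.ofCoords φ ip x) (Heintze.ofCoords φ ip y) := by
  refine le_of_forall_gt fun r hr => ?_
  obtain ⟨γ, h0, h1, hγ, hl⟩ := exists_len_lt hr
  refine lt_of_le_of_lt ?_ hl
  rw [← len_leftTranslate hφ p hγ]
  have := edist_ofCoords_le_len (φ := φ) (ip := ip) zero_le_one
    (((contMDiff_leftTranslate hφ p).of_le (by simp)).comp_contMDiffOn hγ)
  simp only [Function.comp_apply, h0, h1] at this
  exact this

theorem edist_leftTranslate (hφ : IsSmoothFlow E φ) (p : N × ℝ) (x y : N × ℝ) :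
    edist (Heintze.ofCoords φ ip (leftTranslate φ p x))
      (Heintze.ofCoords φ ip (leftTranslate φ p y)) =
      edist (Heintze.ofCoords φ ip x) (Heintze.ofCoords φ ip y) := by
  refine le_antisymm (edist_leftTranslate_le hφ p x y) ?_
  -- `leftTranslate φ p (1, 0)` is `p⁻¹`, so translating by it undoes `leftTranslate φ p`.
  have h := edist_leftTranslate_le (ip := ip) hφ (leftTranslate φ p (1, 0)) (leftTranslate φ p x)
    (leftTranslate φ p y)
  simpa only [leftTranslate_leftTranslate, leftTranslate_one] using h

/-- The left invariant distance of the vertical geodesic through `g` and the one through `g'`, at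
height `t`. -/
theorem edist_vertical_eq (hφ : IsSmoothFlow E φ) (g g' : N) (s t : ℝ) :
    edist (Heintze.vertical (φ := φ) ip g s) (Heintze.vertical (φ := φ) ip g' t) =
      edist (Heintze.vertical (φ := φ) ip 1 0)
        (Heintze.vertical (φ := φ) ip (flow φ (-s) (g⁻¹ * g')) (t - s)) := by
  have h := edist_leftTranslate (ip := ip) hφ (g, s) (g, s) (g', t)
  rw [leftTranslate_self, leftTranslate_eq] at h
  exact h.symm

theorem inner_zero_core (ip : InnerProductSpace.Core ℝ (GroupLieAlgebra 𝓘(ℝ, E) N)) :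
    ip.inner 0 0 = 0 := by
  simpa using ip.smul_left 0 0 0

theorem edist_vertical_le (hφ : IsSmoothFlow E φ) (g : N) (s t : ℝ) :
    edist (Heintze.vertical (φ := φ) ip g s) (Heintze.vertical (φ := φ) ip g t) ≤
      edist s t := by
  wlog hst : s ≤ t generalizing s t
  · rw [edist_comm, edist_comm s]
    exact this t s (le_of_not_ge hst)
  have hγ : ContMDiff 𝓘(ℝ, ℝ) (𝓘(ℝ, E).prod 𝓘(ℝ, ℝ)) 1 (fun u : ℝ => (g, u)) :=
    contMDiff_const.prodMk contMDiff_id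
  refine (edist_ofCoords_le_len (φ := φ) (ip := ip) hst hγ.contMDiffOn).trans ?_
  rcases hst.eq_or_lt with rfl | hlt
  · rw [len_eq]; simp
  rw [len_eq]
  have h1 : ∀ u ∈ Icc s t, ENNReal.ofReal (tangentNorm φ ip (g, u)
      (mfderivWithin 𝓘(ℝ, ℝ) (𝓘(ℝ, E).prod 𝓘(ℝ, ℝ)) (fun u : ℝ => (g, u)) (Icc s t) u 1)) = 1 := by
    intro u hu
    have h2 : HasMFDerivAt 𝓘(ℝ, ℝ) (𝓘(ℝ, E).prod 𝓘(ℝ, ℝ)) (fun u : ℝ => (g, u)) u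
        ((0 : ℝ →L[ℝ] E).prod (ContinuousLinearMap.id ℝ ℝ)) :=
      (hasMFDerivAt_const g u).prodMk (hasMFDerivAt_id u)
    have h3 := h2.hasMFDerivWithinAt (s := Icc s t) |>.mfderivWithin
      (uniqueMDiffWithinAt_iff_uniqueDiffWithinAt.2 (uniqueDiffOn_Icc hlt _ hu))
    have h4 : toIdentity φ (g, u)
      (mfderivWithin 𝓘(ℝ, ℝ) (𝓘(ℝ, E).prod 𝓘(ℝ, ℝ)) (fun u : ℝ => (g, u)) (Icc s t) u 1) =
        (0, 1) := by
      rw [toIdentity_apply hφ, h3]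
      refine Prod.ext ?_ rfl
      exact map_zero (mfderiv 𝓘(ℝ, E) 𝓘(ℝ, E) (fun x => flow φ (-u) (g⁻¹ * x)) g)
    simp only [tangentNorm, h4, inner_zero_core]
    simp
  rw [MeasureTheory.setLIntegral_congr_fun measurableSet_Icc h1]
  simp [edist_dist, Real.dist_eq, abs_of_nonpos (sub_nonpos.2 hst)]

theorem realDeriv_snd (p : N × ℝ) (w : TangentSpace (𝓘(ℝ, E).prod 𝓘(ℝ, ℝ)) p) :
    realDeriv (𝓘(ℝ, E).prod 𝓘(ℝ, ℝ)) (Prod.snd : N × ℝ → ℝ) p w = w.2 := by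
  rw [realDeriv, mfderiv_snd]
  rfl

theorem abs_snd_le_tangentNorm (hφ : IsSmoothFlow E φ) (p : N × ℝ)
    (w : TangentSpace (𝓘(ℝ, E).prod 𝓘(ℝ, ℝ)) p) : |(w.2 : ℝ)| ≤ tangentNorm φ ip p w := by
  have h : (toIdentity φ p w).2 = w.2 := by rw [toIdentity_apply hφ]
  have h1 : 0 ≤ ip.inner (toIdentity φ p w).1 (toIdentity φ p w).1 := ip.re_inner_nonneg _
  rw [tangentNorm, ← Real.sqrt_sq_eq_abs]
  refine Real.sqrt_le_sqrt ?_
  rw [h]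
  exact le_add_of_nonneg_left h1

theorem ofReal_height_sub_le_len (hφ : IsSmoothFlow E φ) {γ : ℝ → N × ℝ} {a b : ℝ} (hab : a ≤ b)
    (hγ : ContMDiffOn 𝓘(ℝ, ℝ) (𝓘(ℝ, E).prod 𝓘(ℝ, ℝ)) 1 γ (Icc a b)) :
    ENNReal.ofReal |(γ b).2 - (γ a).2| ≤ len φ ip γ a b := by
  refine ofReal_abs_sub_le_len hab hγ contMDiff_snd fun t _ w => ?_
  rw [realDeriv_snd]
  exact abs_snd_le_tangentNorm hφ _ w

theorem edist_height_le (hφ : IsSmoothFlow E φ) (p q : Heintze φ ip) :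
    edist p.height q.height ≤ edist p q := by
  refine le_of_forall_gt fun r hr => ?_
  obtain ⟨γ, h0, h1, hγ, hl⟩ := exists_len_lt hr
  refine lt_of_le_of_lt ?_ hl
  have := ofReal_height_sub_le_len (ip := ip) hφ zero_le_one hγ
  rw [h0, h1] at this
  rwa [edist_comm, edist_dist, Real.dist_eq]

end Invariance

end

/-! ### Compactly supported functions on `N` have bounded gradient at bounded heights. -/

noncomputable section

/-- Equivalence of norms in finite dimension. Allowing two spaces lets it be applied to the identity
of one vector space carrying two norms. -/
theorem exists_norm_le_of_linearEquiv {V W : Type*} [NormedAddCommGroup V] [NormedSpace ℝ V]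
    [FiniteDimensional ℝ V] [NormedAddCommGroup W] [NormedSpace ℝ W] (e : V ≃ₗ[ℝ] W) :
    ∃ C : ℝ, 0 < C ∧ ∀ x, ‖e x‖ ≤ C * ‖x‖ ∧ ‖x‖ ≤ C * ‖e x‖ := by
  have : FiniteDimensional ℝ W := e.finiteDimensional
  obtain ⟨C₁, h₁, h₁'⟩ := (LinearMap.toContinuousLinearMap e.toLinearMap).bound
  obtain ⟨C₂, h₂, h₂'⟩ := (LinearMap.toContinuousLinearMap e.symm.toLinearMap).bound
  refine ⟨max C₁ C₂, lt_max_of_lt_left h₁, fun x => ⟨(h₁' x).trans ?_, ?_⟩⟩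
  · gcongr; exact le_max_left _ _
  · have := h₂' (e x)
    simp only [LinearMap.coe_toContinuousLinearMap', LinearEquiv.coe_coe,
      LinearEquiv.symm_apply_apply] at this
    refine this.trans ?_
    gcongr; exact le_max_right _ _

theorem exists_norm_le_sqrt_inner {V : Type*} [NormedAddCommGroup V] [NormedSpace ℝ V]
    [FiniteDimensional ℝ V] (ip : InnerProductSpace.Core ℝ V) :
    ∃ C : ℝ, 0 < C ∧ ∀ x, √(ip.inner x x) ≤ C * ‖x‖ ∧ ‖x‖ ≤ C * √(ip.inner x x) := 
  @exists_norm_le_of_linearEquiv V V _ _ _ (@InnerProductSpace.Core.toNormedAddCommGroup ℝ V _ _ _ ip)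
    (@InnerProductSpace.Core.toNormedSpace ℝ V _ _ _ ip.toCore)
    (LinearEquiv.refl ℝ V)

variable {E : Type*} [NormedAddCommGroup E] [NormedSpace ℝ E]
  {N : Type*} [TopologicalSpace N] [ChartedSpace E N] [Group N] [LieGroup 𝓘(ℝ, E) ∞ N]
  {φ : Multiplicative ℝ →* MulAut N}

variable (φ) in
/-- The derivative of a function on `N` at `g`, in the left invariant frame at `(g, t)`. -/
def frameDeriv (f : N → ℝ) (p : N × ℝ) : E →L[ℝ] ℝ :=
  mfderiv 𝓘(ℝ, E) 𝓘(ℝ, ℝ) (fun x => f (p.1 * flow φ p.2 x)) (1 : N)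

/-- The map `(p, x) ↦ f (p.1 * flow φ p.2 x)` is jointly smooth, so its `x`-derivative at `1`
depends continuously on `p`. -/
theorem continuous_frameDeriv (hφ : IsSmoothFlow E φ) {f : N → ℝ}
    (hf : ContMDiff 𝓘(ℝ, E) 𝓘(ℝ, ℝ) ∞ f) : Continuous (frameDeriv (E := E) φ f) := by
  have : IsManifold 𝓘(ℝ, E) 1 N := IsManifold.of_le (n := ∞) (by simp)
  rw [continuous_iff_continuousAt]
  intro p
  have h : ContMDiffAt (𝓘(ℝ, E).prod 𝓘(ℝ, ℝ)) 𝓘(ℝ, E →L[ℝ] ℝ) 0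
      (inTangentCoordinates 𝓘(ℝ, E) 𝓘(ℝ, ℝ) (fun _ : N × ℝ => (1 : N))
        (fun q => f (q.1 * flow φ q.2 1)) (frameDeriv φ f) p) p :=
    ContMDiffAt.mfderiv (n := 1) (fun (p : N × ℝ) (x : N) => f (p.1 * flow φ p.2 x))
      (fun _ => (1 : N)) ?_ contMDiffAt_const (by simp)
  · refine h.continuousAt.congr (Eventually.of_forall fun q => ?_)
    have h1 : (1 : N) ∈ (chartAt E (1 : N)).source := mem_chart_source E 1
    rw [inTangentCoordinates_eq (fun _ : N × ℝ => (1 : N)) _ _ h1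
      (by rw [chartAt_self_eq]; exact mem_univ _)]
    ext v
    have h2 := (tangentBundleCore 𝓘(ℝ, E) N).coordChange_self (achart E (1 : N)) 1 h1 v
    rw [tangentBundleCore_coordChange_model_space]
    exact congrArg (frameDeriv (E := E) φ f q) h2
  · refine ContMDiff.contMDiffAt (ContMDiff.of_le ?_ (n := ∞) (by simp))
    refine hf.comp (ContMDiff.mul ?_ ?_)
    · exact contMDiff_fst.comp contMDiff_fst
    · exact hφ.contMDiff_flow (contMDiff_snd.comp contMDiff_fst) contMDiff_snd

theorem realDeriv_eq_frameDeriv (hφ : IsSmoothFlow E φ) {f : N → ℝ}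
    (hf : ContMDiff 𝓘(ℝ, E) 𝓘(ℝ, ℝ) ∞ f) (p : N × ℝ)
    (w : TangentSpace (𝓘(ℝ, E).prod 𝓘(ℝ, ℝ)) p) :
    realDeriv 𝓘(ℝ, E) f p.1 w.1 = frameDeriv (E := E) φ f p (toIdentity φ p w).1 := by
  have h : f = (fun x => f (p.1 * flow φ p.2 x)) ∘ fun x => flow φ (-p.2) (p.1⁻¹ * x) := by
    ext x
    simp [flow_flow_neg]
  have h1 : MDifferentiableAt 𝓘(ℝ, E) 𝓘(ℝ, E) (fun x => flow φ (-p.2) (p.1⁻¹ * x)) p.1 :=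
    (hφ.contMDiff_flow contMDiff_const contMDiff_mul_left).mdifferentiable (by simp) p.1
  have h2 : ContMDiff 𝓘(ℝ, E) 𝓘(ℝ, ℝ) ∞ (fun x => f (p.1 * flow φ p.2 x)) :=
    hf.comp (contMDiff_const.mul (hφ.contMDiff_flow contMDiff_const contMDiff_id))
  have h3 := mfderiv_comp p.1 (h2.mdifferentiable (by simp) _) h1
  rw [← h] at h3
  -- The chain rule gives the derivative at `flow φ (-p.2) (p.1⁻¹ * p.1)`, which equals `1` only
  -- propositionally; generalizing the base point allows the rewriting.
  have h4 : ∀ y : N, y = 1 → ∀ v : E,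
      realDeriv 𝓘(ℝ, E) (fun x => f (p.1 * flow φ p.2 x)) y v = frameDeriv (E := E) φ f p v := by
    rintro y rfl v
    rfl
  refine Eq.trans ?_ (h4 (flow φ (-p.2) (p.1⁻¹ * p.1)) (by simp) (toIdentity φ p w).1)
  refine (congrArg (fun l => l w.1) h3).trans ?_
  rw [toIdentity_apply hφ]
  rfl

/-- `frameDeriv` is bounded on the compact set `tsupport f ×ˢ Icc (-T) T`, and the derivative
vanishes off the support. The constant depends on `T` because the left invariant frame varies with
the height. -/
theorem exists_abs_realDeriv_le [FiniteDimensional ℝ E] (hφ : IsSmoothFlow E φ)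
    (ip : InnerProductSpace.Core ℝ (GroupLieAlgebra 𝓘(ℝ, E) N)) {f : N → ℝ}
    (hf : ContMDiff 𝓘(ℝ, E) 𝓘(ℝ, ℝ) ∞ f) (hc : HasCompactSupport f) (T : ℝ) :
    ∃ C : ℝ, 0 < C ∧ ∀ p : N × ℝ, |p.2| ≤ T → ∀ w : TangentSpace (𝓘(ℝ, E).prod 𝓘(ℝ, ℝ)) p,
      |realDeriv 𝓘(ℝ, E) f p.1 w.1| ≤
        C * √(ip.inner (toIdentity φ p w).1 (toIdentity φ p w).1) := by
  obtain ⟨C₁, h₁, h₁'⟩ := exists_norm_le_sqrt_inner (V := E) ip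
  have hK : IsCompact (tsupport f ×ˢ Icc (-T) T) := hc.isCompact.prod isCompact_Icc
  obtain ⟨C₂, h₂⟩ := hK.exists_bound_of_continuousOn (continuous_frameDeriv hφ hf).continuousOn
  refine ⟨max C₂ 1 * C₁, by positivity, fun p hp w => ?_⟩
  by_cases hg : p.1 ∈ tsupport f
  · rw [realDeriv_eq_frameDeriv hφ hf]
    have h3 : ‖frameDeriv (E := E) φ f p‖ ≤ max C₂ 1 :=
      (h₂ p ⟨hg, abs_le.1 hp⟩).trans (le_max_left _ _)
    have h4 := ((frameDeriv (E := E) φ f p).le_of_opNorm_le h3 (toIdentity φ p w).1)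
    rw [Real.norm_eq_abs] at h4
    refine h4.trans ?_
    rw [mul_assoc]
    exact mul_le_mul_of_nonneg_left (h₁' _).2 (by positivity)
  · have h3 : f =ᶠ[𝓝 p.1] fun _ => 0 := notMem_tsupport_iff_eventuallyEq.1 hg
    have h4 (v : TangentSpace 𝓘(ℝ, E) p.1) : realDeriv 𝓘(ℝ, E) f p.1 v = 0 := by
      unfold realDeriv
      rw [h3.mfderiv_eq, mfderiv_const]
      rfl
    refine (congrArg abs (h4 w.1)).le.trans ?_
    rw [abs_zero]
    positivity

end

/-! ### Lower bounds for the distance of `G_φ`. -/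

noncomputable section

variable {E : Type*} [NormedAddCommGroup E] [NormedSpace ℝ E]
  {N : Type*} [TopologicalSpace N] [ChartedSpace E N] [Group N] [LieGroup 𝓘(ℝ, E) ∞ N]
  {φ : Multiplicative ℝ →* MulAut N}
  {ip : InnerProductSpace.Core ℝ (GroupLieAlgebra 𝓘(ℝ, E) N)}

theorem abs_add_le_sqrt {c s x y A : ℝ} (hcs : c ^ 2 + s ^ 2 ≤ 1) (hA : 0 ≤ A) (hy : |y| ≤ √A) :
    |c * x + s * y| ≤ √(A + x ^ 2) := by
  have h1 : y ^ 2 ≤ A := by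
    have := pow_le_pow_left₀ (abs_nonneg y) hy 2
    rwa [sq_abs, Real.sq_sqrt hA] at this
  refine Real.abs_le_sqrt ?_
  nlinarith [sq_nonneg (c * y - s * x), sq_nonneg x, sq_nonneg y,
    mul_le_mul_of_nonneg_right hcs (add_nonneg (sq_nonneg x) (sq_nonneg y))]

/-- The gradients of the height and of `f / C` are orthogonal and of norm at most `1`, so `c *
height + (s / C) * f` has gradient at most `1` at heights in `[-T, T]`. -/
theorem ofReal_abs_height_add_le_len (hφ : IsSmoothFlow E φ) {f : N → ℝ}
    (hf : ContMDiff 𝓘(ℝ, E) 𝓘(ℝ, ℝ) ∞ f) {C T : ℝ} (hC : 0 < C)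
    (h : ∀ p : N × ℝ, |p.2| ≤ T → ∀ w : TangentSpace (𝓘(ℝ, E).prod 𝓘(ℝ, ℝ)) p,
      |realDeriv 𝓘(ℝ, E) f p.1 w.1| ≤
        C * √(ip.inner (toIdentity φ p w).1 (toIdentity φ p w).1))
    {c s : ℝ} (hcs : c ^ 2 + s ^ 2 ≤ 1) {γ : ℝ → N × ℝ} {a b : ℝ} (hab : a ≤ b)
    (hγ : ContMDiffOn 𝓘(ℝ, ℝ) (𝓘(ℝ, E).prod 𝓘(ℝ, ℝ)) 1 γ (Icc a b))
    (hT : ∀ t ∈ Icc a b, |(γ t).2| ≤ T) :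
    ENNReal.ofReal |c * ((γ b).2 - (γ a).2) + s / C * (f (γ b).1 - f (γ a).1)| ≤
      len φ ip γ a b := by
  let H : N × ℝ → ℝ := c • Prod.snd + (s / C) • (f ∘ Prod.fst)
  have hfst : ContMDiff (𝓘(ℝ, E).prod 𝓘(ℝ, ℝ)) 𝓘(ℝ, ℝ) ∞ (f ∘ Prod.fst : N × ℝ → ℝ) :=
    hf.comp contMDiff_fst
  have hH : ContMDiff (𝓘(ℝ, E).prod 𝓘(ℝ, ℝ)) 𝓘(ℝ, ℝ) 1 H :=
    (((contDiff_const_smul c).contMDiff.comp contMDiff_snd).add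
      ((contDiff_const_smul (s / C)).contMDiff.comp hfst)).of_le (by simp)
  have hHd : ∀ (p : N × ℝ) (w : TangentSpace (𝓘(ℝ, E).prod 𝓘(ℝ, ℝ)) p),
      realDeriv (𝓘(ℝ, E).prod 𝓘(ℝ, ℝ)) H p w =
        c * w.2 + s * (realDeriv 𝓘(ℝ, E) f p.1 w.1 / C) := by
    intro p w
    have h1 : HasMFDerivAt (𝓘(ℝ, E).prod 𝓘(ℝ, ℝ)) 𝓘(ℝ, ℝ) (Prod.snd : N × ℝ → ℝ) p
      (ContinuousLinearMap.snd ℝ E ℝ) := hasMFDerivAt_snd p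
    have h2 : HasMFDerivAt (𝓘(ℝ, E).prod 𝓘(ℝ, ℝ)) 𝓘(ℝ, ℝ) (f ∘ Prod.fst : N × ℝ → ℝ) p
      ((mfderiv 𝓘(ℝ, E) 𝓘(ℝ, ℝ) f p.1).comp (ContinuousLinearMap.fst ℝ E ℝ)) :=
      ((hf.mdifferentiable (by simp) p.1).hasMFDerivAt).comp p (hasMFDerivAt_fst p)
    have h3 := ((h1.const_smul c).add (h2.const_smul (s / C))).mfderiv
    refine (congrArg (fun l => l w) h3).trans ?_
    have h4 : s * (realDeriv 𝓘(ℝ, E) f p.1 w.1 / C) = s / C * realDeriv 𝓘(ℝ, E) f p.1 w.1 := by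
      ring
    rw [h4]
    rfl
  have := ofReal_abs_sub_le_len (φ := φ) (ip := ip) hab hγ hH fun t ht w => by
    rw [hHd, tangentNorm]
    have h5 : (toIdentity φ (γ t) w).2 = w.2 := by rw [toIdentity_apply hφ]
    rw [h5]
    refine abs_add_le_sqrt hcs (ip.re_inner_nonneg _) ?_
    rw [abs_div, abs_of_pos hC, div_le_iff₀' hC]
    exact h _ (hT t ht) w
  refine le_trans (le_of_eq ?_) this
  congr 2
  simp only [H, Pi.add_apply, Pi.smul_apply, smul_eq_mul, Function.comp_apply]
  ring

theorem abs_height_le_of_len_lt (hφ : IsSmoothFlow E φ) {γ : ℝ → N × ℝ} {r : ℝ}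
    (hγ : ContMDiffOn 𝓘(ℝ, ℝ) (𝓘(ℝ, E).prod 𝓘(ℝ, ℝ)) 1 γ (Icc 0 1)) (h0 : (γ 0).2 = 0)
    (hl : len φ ip γ 0 1 < ENNReal.ofReal r) : ∀ t ∈ Icc (0 : ℝ) 1, |(γ t).2| ≤ r := by
  intro t ht
  have h1 := ofReal_height_sub_le_len (ip := ip) hφ ht.1 (hγ.mono (Icc_subset_Icc_right ht.2))
  have h2 : len φ ip γ 0 t ≤ len φ ip γ 0 1 := by
    rw [← len_add ht.1 ht.2]; exact le_self_add
  rw [h0, sub_zero] at h1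
  exact (ENNReal.ofReal_lt_ofReal_iff'.1 ((h1.trans h2).trans_lt hl)).1.le

variable [FiniteDimensional ℝ E] [T2Space N]

omit [Group N] [LieGroup 𝓘(ℝ, E) ∞ N] in
theorem exists_smooth_bump [IsManifold 𝓘(ℝ, E) ∞ N] {x : N} {U : Set N} (hU : U ∈ 𝓝 x) :
    ∃ f : N → ℝ, ContMDiff 𝓘(ℝ, E) 𝓘(ℝ, ℝ) ∞ f ∧ HasCompactSupport f ∧ f x = 1 ∧
      ∀ y ∉ U, f y = 0 := by
  obtain ⟨f, -, hf⟩ := (SmoothBumpFunction.nhds_basis_tsupport (I := 𝓘(ℝ, E)) x).mem_iff.1 hU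
  exact ⟨f, f.contMDiff, f.hasCompactSupport, f.eq_one, fun y hy =>
    image_eq_zero_of_notMem_tsupport fun h => hy (hf h)⟩

/-- A bump function at `1` supported in `U` has to drop by `1` along a path whose `N`-component ends
outside `U`, which bounds the length of the path from below. -/
theorem exists_edist_lt_imp_mem (hφ : IsSmoothFlow E φ)
    (ip : InnerProductSpace.Core ℝ (GroupLieAlgebra 𝓘(ℝ, E) N)) {U : Set N}
    (hU : U ∈ 𝓝 (1 : N)) :
    ∃ r : ℝ, 0 < r ∧ ∀ g t, edist (Heintze.vertical (φ := φ) ip 1 0) (Heintze.vertical ip g t) <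
      ENNReal.ofReal r → g ∈ U := by
  obtain ⟨f, hf, hfc, hf1, hfU⟩ := exists_smooth_bump (E := E) hU
  obtain ⟨C, hC, h⟩ := exists_abs_realDeriv_le hφ ip hf hfc 1
  -- The `1` keeps the path at heights in `[-1, 1]`, where `C` is valid; `1 / C` is the cost of the
  -- drop.
  refine ⟨min 1 (1 / C), by positivity, fun g t hlt => ?_⟩
  by_contra hg
  obtain ⟨γ, h0, h1, hγ, hl⟩ := exists_len_lt hlt
  have hT := abs_height_le_of_len_lt hφ hγ (by rw [h0]; rfl)
    (hl.trans_le (ENNReal.ofReal_le_ofReal (min_le_left _ _)))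
  have h2 := ofReal_abs_height_add_le_len hφ hf hC h (c := 0) (s := 1) (by norm_num) zero_le_one
    hγ hT
  have h3 := (ENNReal.ofReal_lt_ofReal_iff'.1 (h2.trans_lt hl)).1
  rw [h0, h1] at h3
  simp only [Heintze.coords_vertical, hf1, hfU g hg] at h3
  have h4 : |0 * (t - 0) + 1 / C * (0 - 1)| = 1 / C := by
    rw [show 0 * (t - 0) + 1 / C * (0 - 1) = -(1 / C) by ring, abs_neg, abs_of_pos (by positivity)]
  rw [h4] at h3
  exact (h3.trans_le (min_le_right _ _)).false

/-- Rigidity of vertical lines. If `g ≠ 1`, a bump separating `1` from `g` gives `c * |t| + s / C ≤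
|t|` whenever `c² + s² ≤ 1`. For `(c, s)` on the circle close to `(1, 0)` the loss in `c` is of
second order and the gain in `s` of first order, a contradiction. For `t = 0` this says that the
distance separates `(1, 0)` from `(g, 0)`. -/
theorem eq_one_of_edist_le (hφ : IsSmoothFlow E φ)
    (ip : InnerProductSpace.Core ℝ (GroupLieAlgebra 𝓘(ℝ, E) N)) {g : N} {t : ℝ}
    (h : edist (Heintze.vertical (φ := φ) ip 1 0) (Heintze.vertical ip g t) ≤
      ENNReal.ofReal |t|) : g = 1 := by
  by_contra hg
  obtain ⟨f, hf, hfc, hf1, hfU⟩ := exists_smooth_bump (E := E)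
    (isOpen_compl_singleton.mem_nhds (Ne.symm hg) : ({g}ᶜ : Set N) ∈ 𝓝 1)
  obtain ⟨C, hC, hb⟩ := exists_abs_realDeriv_le hφ ip hf hfc (|t| + 1)
  have key : ∀ c s : ℝ, c ^ 2 + s ^ 2 ≤ 1 → c * |t| + s / C ≤ |t| := by
    intro c s hcs
    refine le_of_forall_pos_lt_add fun ε hε => ?_
    have hlt : edist (Heintze.vertical (φ := φ) ip 1 0) (Heintze.vertical ip g t) <
        ENNReal.ofReal (|t| + min ε 1) :=
      h.trans_lt ((ENNReal.ofReal_lt_ofReal_iff (by positivity)).2 (by simp [hε]))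
    obtain ⟨γ, h0, h1, hγ, hl⟩ := exists_len_lt hlt
    have hT := abs_height_le_of_len_lt hφ hγ (by rw [h0]; rfl)
      (hl.trans_le (ENNReal.ofReal_le_ofReal (add_le_add_right (min_le_right _ _) |t|)))
    -- The sign makes the height term gain `c * |t|` also for paths which go down.
    let c' := if 0 ≤ t then c else -c
    have hc' : c' * t = c * |t| := by
      simp only [c']
      split_ifs with ht
      · rw [abs_of_nonneg ht]
      · rw [abs_of_neg (not_le.1 ht)]; ring
    have hc2 : c' ^ 2 = c ^ 2 := by
      simp only [c']; split_ifs <;> ring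
    have h2 := ofReal_abs_height_add_le_len hφ hf hC hb (c := c') (s := -s)
      (by rw [hc2, neg_sq]; exact hcs) zero_le_one hγ hT
    have h3 := (ENNReal.ofReal_lt_ofReal_iff'.1 (h2.trans_lt hl)).1
    rw [h0, h1] at h3
    simp only [Heintze.coords_vertical, hf1, hfU g (by simp)] at h3
    have h4 := (le_abs_self _).trans_lt h3
    have h5 : c' * (t - 0) + -s / C * (0 - 1) = c * |t| + s / C := by
      rw [sub_zero, hc']; ring
    rw [h5] at h4
    exact h4.trans_le (by gcongr; exact min_le_left _ _)
  have h0 := abs_nonneg t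
  -- `δ` parametrizes the circle rationally below. The inequality will give `1 ≤ δ * |t| * C`, which
  -- this choice excludes.
  obtain ⟨δ, hδ0, h6⟩ : ∃ δ : ℝ, 0 < δ ∧ δ * (C * |t| + C + 1) = 1 :=
    ⟨1 / (C * |t| + C + 1), by positivity, one_div_mul_cancel (by positivity)⟩
  have h1 := key ((1 - δ ^ 2) / (1 + δ ^ 2)) (2 * δ / (1 + δ ^ 2)) (by
    rw [div_pow, div_pow, ← add_div, div_le_one (by positivity)]
    nlinarith)
  have h2 : (1 - δ ^ 2) * |t| + 2 * δ / C ≤ |t| * (1 + δ ^ 2) := by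
    have h3 := mul_le_mul_of_nonneg_right h1 (by positivity : 0 ≤ 1 + δ ^ 2)
    refine le_trans (le_of_eq ?_) h3
    field_simp
  have h4 : 2 * δ ≤ 2 * δ ^ 2 * |t| * C := by
    have : 2 * δ / C ≤ 2 * δ ^ 2 * |t| := by linarith
    rwa [div_le_iff₀ hC] at this
  have h5 : 1 ≤ δ * |t| * C := by
    have : δ * 1 ≤ δ * (δ * |t| * C) := by nlinarith
    exact le_of_mul_le_mul_left this hδ0
  nlinarith

end

/-! ### Upper bounds for the distance near the identity, in a chart. -/

noncomputable section

variable {E : Type*} [NormedAddCommGroup E] [NormedSpace ℝ E]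
  {N : Type*} [TopologicalSpace N] [ChartedSpace E N] [Group N]
  {φ : Multiplicative ℝ →* MulAut N}

variable (E N) in
/-- The inverse of the preferred chart at the identity. -/
def chartInv : E → N := (extChartAt 𝓘(ℝ, E) (1 : N)).symm

variable (E N) in
/-- The derivative of `chartInv` at `v`, in the left invariant frame. -/
def chartFrame (v : E) : E →L[ℝ] E :=
  mfderiv 𝓘(ℝ, E) 𝓘(ℝ, E) (fun w => (chartInv E N v)⁻¹ * chartInv E N w) v

variable [LieGroup 𝓘(ℝ, E) ∞ N]

theorem contMDiffAt_chartInv {v : E} (hv : v ∈ (extChartAt 𝓘(ℝ, E) (1 : N)).target) :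
    ContMDiffAt 𝓘(ℝ, E) 𝓘(ℝ, E) ∞ (chartInv E N) v := by
  have : IsManifold 𝓘(ℝ, E) ∞ N := inferInstance
  exact (contMDiffOn_extChartAt_symm (1 : N)).contMDiffAt
    ((isOpen_extChartAt_target (1 : N)).mem_nhds hv)

/-- Continuity at the centre of the chart suffices: it bounds `chartFrame` on a neighbourhood, which
is all that the length estimate needs. -/
theorem continuousAt_chartFrame :
    ContinuousAt (chartFrame E N) (extChartAt 𝓘(ℝ, E) (1 : N) 1) := by
  have : IsManifold 𝓘(ℝ, E) 1 N := IsManifold.of_le (n := ∞) (by simp)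
  set c := extChartAt 𝓘(ℝ, E) (1 : N) 1 with hc
  have hct : c ∈ (extChartAt 𝓘(ℝ, E) (1 : N)).target := mem_extChartAt_target 1
  have h : ContMDiffAt 𝓘(ℝ, E) 𝓘(ℝ, E →L[ℝ] E) 0
      (inTangentCoordinates 𝓘(ℝ, E) 𝓘(ℝ, E) (id : E → E)
        (fun v => (chartInv E N v)⁻¹ * chartInv E N v) (chartFrame E N) c) c := by
    refine ContMDiffAt.mfderiv (n := 1) (fun v w : E => (chartInv E N v)⁻¹ * chartInv E N w)
      (id : E → E) ?_ contMDiffAt_id (by simp)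
    refine ContMDiffAt.of_le (n := ∞) ?_ (by simp)
    refine ContMDiffAt.mul (ContMDiffAt.inv ?_) ?_
    · exact (contMDiffAt_chartInv (v := c) hct).comp (c, c) contMDiffAt_fst
    · exact (contMDiffAt_chartInv (v := c) hct).comp (c, c) contMDiffAt_snd
  have h0 : (fun v => (chartInv E N v)⁻¹ * chartInv E N v) = fun _ => 1 := by
    funext v; exact inv_mul_cancel _
  rw [h0] at h
  refine h.continuousAt.congr (Eventually.of_forall fun v => ?_)
  have h1 : (1 : N) ∈ (chartAt E (1 : N)).source := mem_chart_source E 1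
  rw [inTangentCoordinates_eq (id : E → E) (fun _ => (1 : N)) _
    (by rw [chartAt_self_eq]; exact mem_univ _) h1]
  ext w
  have h2 := (tangentBundleCore 𝓘(ℝ, E) N).coordChange_self (achart E (1 : N)) 1 h1
  rw [tangentBundleCore_coordChange_model_space]
  exact h2 (chartFrame E N v w)

theorem toIdentity_mfderiv_chartInv (hφ : IsSmoothFlow E φ) {v : E}
    (hv : v ∈ (extChartAt 𝓘(ℝ, E) (1 : N)).target) (u : E) :
    toIdentity φ (chartInv E N v, 0) (mfderiv 𝓘(ℝ, E) (𝓘(ℝ, E).prod 𝓘(ℝ, ℝ))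
      (fun w => (chartInv E N w, (0 : ℝ))) v u) = (chartFrame E N v u, 0) := by
  have h1 : MDifferentiableAt 𝓘(ℝ, E) 𝓘(ℝ, E) (chartInv E N) v :=
    (contMDiffAt_chartInv hv).mdifferentiableAt (by simp)
  have h2 := (h1.hasMFDerivAt.prodMk (hasMFDerivAt_const (I := 𝓘(ℝ, E)) (I' := 𝓘(ℝ, ℝ)) (0 : ℝ) v)).mfderiv
  have h3 : (fun w => (chartInv E N v)⁻¹ * chartInv E N w) =
      (fun x => flow φ (-0) ((chartInv E N v)⁻¹ * x)) ∘ chartInv E N := by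
    ext w; simp [flow_zero]
  have h4 : MDifferentiableAt 𝓘(ℝ, E) 𝓘(ℝ, E)
      (fun x => flow φ (-0) ((chartInv E N v)⁻¹ * x)) (chartInv E N v) :=
    (hφ.contMDiff_flow contMDiff_const contMDiff_mul_left).mdifferentiable (by simp) _
  have h5 := mfderiv_comp v h4 h1
  rw [← h3] at h5
  rw [toIdentity_apply hφ, h2]
  refine Prod.ext ?_ rfl
  exact (congrArg (fun l => l u) h5).symm

variable [FiniteDimensional ℝ E]
variable (ip : InnerProductSpace.Core ℝ (GroupLieAlgebra 𝓘(ℝ, E) N))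

/-- The image of a straight segment of the chart, at height `0`, has speed at most a constant times
the length of the segment. -/
theorem exists_edist_chartInv_le (hφ : IsSmoothFlow E φ) :
    ∃ C : ℝ, ∀ᶠ v in 𝓝 (extChartAt 𝓘(ℝ, E) (1 : N) 1),
      edist (Heintze.vertical (φ := φ) ip 1 0) (Heintze.vertical ip (chartInv E N v) 0) ≤
        ENNReal.ofReal (C * ‖v - extChartAt 𝓘(ℝ, E) (1 : N) 1‖) := by
  set c := extChartAt 𝓘(ℝ, E) (1 : N) 1 with hc
  obtain ⟨C₁, h₁, h₁'⟩ := exists_norm_le_sqrt_inner (V := E) ip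
  have hb : ∀ᶠ v in 𝓝 c, v ∈ (extChartAt 𝓘(ℝ, E) (1 : N)).target ∧
      ‖chartFrame E N v‖ < ‖chartFrame E N c‖ + 1 := by
    refine Eventually.and
      ((isOpen_extChartAt_target (1 : N)).mem_nhds (mem_extChartAt_target 1)) ?_
    exact (continuousAt_chartFrame (E := E) (N := N)).norm.eventually_lt_const (lt_add_one _)
  obtain ⟨r, hr, hball⟩ := Metric.eventually_nhds_iff_ball.1 hb
  set C₂ := ‖chartFrame E N c‖ + 1 with hC₂
  refine ⟨C₁ * C₂, Filter.mem_of_superset (Metric.ball_mem_nhds c hr) fun v hv => ?_⟩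
  let η : ℝ → E := fun s => c + s • (v - c)
  let γ : ℝ → N × ℝ := (fun w => (chartInv E N w, (0 : ℝ))) ∘ η
  have hη : ∀ s ∈ Icc (0 : ℝ) 1, η s ∈ Metric.ball c r := by
    intro s hs
    rw [Metric.mem_ball, dist_eq_norm] at hv ⊢
    simp only [η, add_sub_cancel_left, norm_smul, Real.norm_eq_abs, abs_of_nonneg hs.1]
    exact (mul_le_of_le_one_left (norm_nonneg _) hs.2).trans_lt hv
  have hηd : ∀ s, HasFDerivAt η (ContinuousLinearMap.toSpanSingleton ℝ (v - c)) s := by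
    intro s
    have := ((hasDerivAt_id s).smul_const (v - c)).const_add c
    rw [one_smul] at this
    exact this.hasFDerivAt
  have hΦ : ∀ s ∈ Icc (0 : ℝ) 1, ContMDiffAt 𝓘(ℝ, E) (𝓘(ℝ, E).prod 𝓘(ℝ, ℝ)) ∞
      (fun w => (chartInv E N w, (0 : ℝ))) (η s) := fun s hs =>
    (contMDiffAt_chartInv (hball _ (hη s hs)).1).prodMk contMDiffAt_const
  have hγ : ContMDiffOn 𝓘(ℝ, ℝ) (𝓘(ℝ, E).prod 𝓘(ℝ, ℝ)) 1 γ (Icc 0 1) := by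
    intro s hs
    refine ((ContMDiffAt.comp s (hΦ s hs) ?_).of_le (by simp)).contMDiffWithinAt
    exact (contDiff_const.add (contDiff_id.smul contDiff_const)).contMDiff.contMDiffAt
  have h2 := edist_ofCoords_le_len (φ := φ) (ip := ip) zero_le_one hγ
  have h3 : γ 0 = (1, 0) := by
    simp only [γ, η, Function.comp_apply, zero_smul, add_zero, chartInv, hc]
    rw [extChartAt_to_inv]
  have h4 : γ 1 = (chartInv E N v, 0) := by
    simp [γ, η]
  rw [h3, h4] at h2
  refine h2.trans ?_
  rw [len_eq]
  have h5 : ∀ s ∈ Icc (0 : ℝ) 1, ENNReal.ofReal (tangentNorm φ ip (γ s)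
      (mfderivWithin 𝓘(ℝ, ℝ) (𝓘(ℝ, E).prod 𝓘(ℝ, ℝ)) γ (Icc 0 1) s 1)) ≤
        ENNReal.ofReal (C₁ * C₂ * ‖v - c‖) := by
    intro s hs
    refine ENNReal.ofReal_le_ofReal ?_
    have h6 := (((hΦ s hs).mdifferentiableAt (by simp)).hasMFDerivAt.comp s
      (hηd s).hasMFDerivAt).hasMFDerivWithinAt (s := Icc 0 1) |>.mfderivWithin
      (uniqueMDiffWithinAt_iff_uniqueDiffWithinAt.2 (uniqueDiffOn_Icc zero_lt_one _ hs))
    have h7 : toIdentity φ (γ s)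
        (mfderivWithin 𝓘(ℝ, ℝ) (𝓘(ℝ, E).prod 𝓘(ℝ, ℝ)) γ (Icc 0 1) s 1) =
        (chartFrame E N (η s) (v - c), 0) := by
      rw [← toIdentity_mfderiv_chartInv hφ (hball _ (hη s hs)).1]
      have h8 : (ContinuousLinearMap.toSpanSingleton ℝ (v - c)) (1 : ℝ) = v - c := by simp
      rw [← h8]
      exact congrArg (fun l => toIdentity φ (γ s) (l 1)) h6
    simp only [tangentNorm, h7]
    rw [zero_pow two_ne_zero, add_zero, mul_assoc]
    refine (h₁' _).1.trans (mul_le_mul_of_nonneg_left ?_ h₁.le)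
    exact (chartFrame E N (η s)).le_of_opNorm_le (hball _ (hη s hs)).2.le _
  refine (MeasureTheory.setLIntegral_mono' measurableSet_Icc h5).trans ?_
  simp

theorem eventually_edist_vertical_lt (hφ : IsSmoothFlow E φ) {ε : ℝ≥0∞} (hε : 0 < ε) :
    ∀ᶠ g in 𝓝 (1 : N),
      edist (Heintze.vertical (φ := φ) ip 1 0) (Heintze.vertical ip g 0) < ε := by
  obtain ⟨C, hC⟩ := exists_edist_chartInv_le ip hφ
  have h1 : Tendsto (fun v => ENNReal.ofReal (C * ‖v - extChartAt 𝓘(ℝ, E) (1 : N) 1‖))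
      (𝓝 (extChartAt 𝓘(ℝ, E) (1 : N) 1)) (𝓝 0) := by
    have : Continuous fun v => ENNReal.ofReal (C * ‖v - extChartAt 𝓘(ℝ, E) (1 : N) 1‖) :=
      ENNReal.continuous_ofReal.comp (by fun_prop)
    simpa using this.tendsto (extChartAt 𝓘(ℝ, E) (1 : N) 1)
  have h2 := (continuousAt_extChartAt (I := 𝓘(ℝ, E)) (1 : N)).eventually
    (hC.and (h1.eventually_lt_const hε))
  filter_upwards [h2, extChartAt_source_mem_nhds (I := 𝓘(ℝ, E)) (1 : N)] with g hg hgs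
  have h3 : chartInv E N (extChartAt 𝓘(ℝ, E) (1 : N) g) = g :=
    (extChartAt 𝓘(ℝ, E) (1 : N)).left_inv hgs
  rw [h3] at hg
  exact hg.1.trans_lt hg.2

end

/-! ### `G_φ` as a length space with relatively compact balls. -/

noncomputable section

variable {E : Type*} [NormedAddCommGroup E] [NormedSpace ℝ E]
  {N : Type*} [TopologicalSpace N] [ChartedSpace E N] [Group N] [LieGroup 𝓘(ℝ, E) ∞ N]
  {φ : Multiplicative ℝ →* MulAut N}
  {ip : InnerProductSpace.Core ℝ (GroupLieAlgebra 𝓘(ℝ, E) N)}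

theorem eVariationOn_ofCoords_le {γ : ℝ → N × ℝ} {a b : ℝ}
    (hγ : ContMDiffOn 𝓘(ℝ, ℝ) (𝓘(ℝ, E).prod 𝓘(ℝ, ℝ)) 1 γ (Icc a b)) :
    eVariationOn (fun t => Heintze.ofCoords φ ip (γ t)) (Icc a b) ≤ len φ ip γ a b := by
  refine iSup_le fun p => ?_
  obtain ⟨n, u, hu, hus⟩ := p
  have h1 : ∀ k, ∑ i ∈ Finset.range k, edist (Heintze.ofCoords φ ip (γ (u (i + 1))))
      (Heintze.ofCoords φ ip (γ (u i))) ≤ len φ ip γ (u 0) (u k) := by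
    intro k
    induction k with
    | zero => simp
    | succ k ih =>
      rw [Finset.sum_range_succ, ← len_add (hu (Nat.zero_le k)) (hu (Nat.le_succ k))]
      refine add_le_add ih ?_
      rw [edist_comm]
      exact edist_ofCoords_le_len (hu (Nat.le_succ k))
        (hγ.mono (Icc_subset_Icc (hus k).1 (hus (k + 1)).2))
  refine (h1 n).trans ?_
  rw [← len_add (hus 0).1 ((hus 0).2), ← len_add (hu (Nat.zero_le n)) (hus n).2]
  exact le_trans le_self_add le_add_self

theorem edist_vertical_same_height (hφ : IsSmoothFlow E φ) (g g' : N) (s : ℝ) :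
    edist (Heintze.vertical (φ := φ) ip g s) (Heintze.vertical (φ := φ) ip g' s) =
      edist (Heintze.vertical (φ := φ) ip 1 0)
        (Heintze.vertical (φ := φ) ip (flow φ (-s) (g⁻¹ * g')) 0) := by
  rw [edist_vertical_eq hφ, sub_self]

theorem edist_vertical (hφ : IsSmoothFlow E φ) (g : N) (s t : ℝ) :
    edist (Heintze.vertical (φ := φ) ip g s) (Heintze.vertical (φ := φ) ip g t) = edist s t :=
  le_antisymm (edist_vertical_le hφ g s t) (edist_height_le hφ _ _)

variable [FiniteDimensional ℝ E]

theorem continuous_ofCoords (hφ : IsSmoothFlow E φ) : Continuous (Heintze.ofCoords φ ip) := by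
  have : IsTopologicalGroup N := topologicalGroup_of_lieGroup 𝓘(ℝ, E) ∞
  rw [continuous_iff_continuousAt]
  intro p
  refine EMetric.tendsto_nhds.2 fun ε hε => ?_
  have h1 : Continuous fun q : N × ℝ => flow φ (-p.2) (p.1⁻¹ * q.1) :=
    hφ.continuous_flow continuous_const (continuous_const.mul continuous_fst)
  have h2 := eventually_edist_vertical_lt (φ := φ) ip hφ (ENNReal.half_pos hε.ne')
  have h3 : Tendsto (fun q : N × ℝ => flow φ (-p.2) (p.1⁻¹ * q.1)) (𝓝 p) (𝓝 1) := by
    simpa using h1.tendsto p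
  have h4 : ∀ᶠ q : N × ℝ in 𝓝 p, edist q.2 p.2 < ε / 2 :=
    EMetric.tendsto_nhds.1 (continuous_snd.tendsto p) _ (ENNReal.half_pos hε.ne')
  filter_upwards [h3.eventually h2, h4] with q hq hq'
  calc edist (Heintze.vertical (φ := φ) ip q.1 q.2) (Heintze.vertical (φ := φ) ip p.1 p.2)
      ≤ edist (Heintze.vertical (φ := φ) ip q.1 q.2) (Heintze.vertical (φ := φ) ip q.1 p.2) +
        edist (Heintze.vertical (φ := φ) ip q.1 p.2) (Heintze.vertical (φ := φ) ip p.1 p.2) :=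
        edist_triangle _ _ _
    _ < ε / 2 + ε / 2 := by
        refine ENNReal.add_lt_add ((edist_vertical_le hφ _ _ _).trans_lt hq') ?_
        rw [edist_comm, edist_vertical_same_height hφ]
        exact hq
    _ = ε := ENNReal.add_halves ε

/-- The Riemannian distance is a length distance. This allows distances of `G_φ` to be lifted to the
path metric of `X`. -/
theorem pathEDist_le_edist (hφ : IsSmoothFlow E φ) (p q : Heintze φ ip) :
    pathEDist p q ≤ edist p q := by
  refine le_of_forall_gt fun r hr => ?_
  obtain ⟨γ, h0, h1, hγ, hl⟩ := exists_len_lt hr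
  let c : Path p q :=
    { toFun := fun u => Heintze.ofCoords φ ip (γ u)
      continuous_toFun := (continuous_ofCoords hφ).comp
        (hγ.continuousOn.comp_continuous continuous_subtype_val fun u => u.2)
      source' := by simp [h0, Heintze.ofCoords_coords]
      target' := by simp [h1, Heintze.ofCoords_coords] }
  refine (iInf_le_of_le c ?_).trans_lt hl
  refine le_trans ?_ (eVariationOn_ofCoords_le hγ)
  exact eVariationOn.comp_le_of_monotoneOn (fun t => Heintze.ofCoords φ ip (γ t)) Subtype.val
    (fun _ _ _ _ h => h) (fun u _ => u.2)

theorem exists_edist_lt_edist_lt (hφ : IsSmoothFlow E φ) {p q : Heintze φ ip} {a b : ℝ}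
    (ha : 0 < a) (hb : 0 < b) (h : edist p q < ENNReal.ofReal (a + b)) :
    ∃ z, edist p z < ENNReal.ofReal a ∧ edist z q < ENNReal.ofReal b := by
  by_cases hpq : edist p q < ENNReal.ofReal a
  · exact ⟨q, hpq, by simpa using hb⟩
  obtain ⟨γ, h0, h1, hγ, hl⟩ := exists_len_lt h
  have hL : len φ ip γ 0 1 = ENNReal.ofReal (len φ ip γ 0 1).toReal :=
    (ENNReal.ofReal_toReal (hl.trans ENNReal.ofReal_lt_top).ne).symm
  set L := (len φ ip γ 0 1).toReal
  rw [hL] at hl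
  have hLab : L < a + b := (ENNReal.ofReal_lt_ofReal_iff'.1 hl).1
  -- At a point of `γ` at distance `a'` from `p`, at least `a'` of the length `L` is used up, and
  -- the rest is at most `L - a' < b`.
  obtain ⟨a', ha1, ha2⟩ := exists_between (max_lt ha (by linarith : L - b < a))
  have hc : ContinuousOn (fun u => edist p (Heintze.ofCoords φ ip (γ u))) (Icc 0 1) :=
    (continuous_const.edist continuous_id : Continuous fun z => edist p z).comp_continuousOn
      ((continuous_ofCoords hφ).comp_continuousOn hγ.continuousOn)
  have hivt := intermediate_value_Icc zero_le_one hc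
  obtain ⟨u, hu, hua⟩ := hivt (show ENNReal.ofReal a' ∈ Icc _ _ by
    simp only [h0, h1, Heintze.ofCoords_coords, edist_self]
    exact ⟨zero_le, (ENNReal.ofReal_le_ofReal ha2.le).trans (not_lt.1 hpq)⟩)
  simp only at hua
  refine ⟨Heintze.ofCoords φ ip (γ u), ?_, ?_⟩
  · rw [hua]
    exact (ENNReal.ofReal_lt_ofReal_iff ha).2 ha2
  · have h2 := edist_ofCoords_le_len (φ := φ) (ip := ip) hu.1 (hγ.mono (Icc_subset_Icc_right hu.2))
    have h3 := edist_ofCoords_le_len (φ := φ) (ip := ip) hu.2 (hγ.mono (Icc_subset_Icc_left hu.1))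
    rw [h0, Heintze.ofCoords_coords, hua] at h2
    rw [h1, Heintze.ofCoords_coords] at h3
    by_contra hcon
    have h4 : ENNReal.ofReal (a' + b) ≤ ENNReal.ofReal L := by
      rw [← hL, ← len_add hu.1 hu.2, ENNReal.ofReal_add ((le_max_left _ _).trans ha1.le) hb.le]
      exact add_le_add h2 ((not_lt.1 hcon).trans h3)
    have h5 := le_max_right 0 (L - b)
    have h6 := le_max_left 0 (L - b)
    rw [ENNReal.ofReal_le_ofReal_iff'] at h4
    rcases h4 with h4 | h4 <;> linarith

variable [T2Space N]

/-- A small ball about the identity lies in a compact set. A point at distance less than `(k + 2) *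
r` is a product of one at distance less than `(k + 1) * r` and one in the small ball, so larger
balls lie in products of compact sets. -/
theorem exists_isCompact_of_edist_lt (hφ : IsSmoothFlow E φ)
    (ip : InnerProductSpace.Core ℝ (GroupLieAlgebra 𝓘(ℝ, E) N)) :
    ∃ r : ℝ, 0 < r ∧ ∀ k : ℕ, ∃ K : Set (N × ℝ), IsCompact K ∧ ∀ p : N × ℝ,
      edist (Heintze.vertical (φ := φ) ip 1 0) (Heintze.ofCoords φ ip p) <
        ENNReal.ofReal ((k + 1) * r) → p ∈ K := by
  have : IsTopologicalGroup N := topologicalGroup_of_lieGroup 𝓘(ℝ, E) ∞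
  have : ProperSpace E := FiniteDimensional.proper ℝ E
  have : LocallyCompactSpace N := ChartedSpace.locallyCompactSpace E N
  obtain ⟨U, hU, hU1⟩ := exists_compact_mem_nhds (1 : N)
  obtain ⟨r, hr, h⟩ := exists_edist_lt_imp_mem hφ ip hU1
  have hbase : ∀ p : N × ℝ, edist (Heintze.vertical (φ := φ) ip 1 0)
      (Heintze.ofCoords φ ip p) < ENNReal.ofReal r → p ∈ U ×ˢ Icc (-r) r := by
    intro p hp
    refine ⟨h _ _ hp, abs_le.1 ?_⟩
    have h1 := (edist_height_le hφ _ _).trans_lt hp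
    have h2 : edist (0 : ℝ) p.2 < ENNReal.ofReal r := h1
    rw [edist_comm, edist_dist, Real.dist_eq, sub_zero] at h2
    exact (ENNReal.ofReal_lt_ofReal_iff'.1 h2).1.le
  refine ⟨r, hr, fun k => ?_⟩
  induction k with
  | zero => exact ⟨_, hU.prod isCompact_Icc, by simpa using hbase⟩
  | succ k ih =>
    obtain ⟨K, hK, hKp⟩ := ih
    refine ⟨_, (hK.prod (hU.prod (isCompact_Icc (a := -r) (b := r)))).image
      (f := fun x : (N × ℝ) × (N × ℝ) => (x.1.1 * flow φ x.1.2 x.2.1, x.1.2 + x.2.2)) ?_, ?_⟩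
    · refine Continuous.prodMk (Continuous.mul (by fun_prop) ?_) (by fun_prop)
      exact hφ.continuous_flow (by fun_prop) (by fun_prop)
    · intro p hp
      rw [show ((k + 1 : ℕ) + 1 : ℝ) * r = (k + 1) * r + r by push_cast; ring] at hp
      obtain ⟨z, hz, hzp⟩ := exists_edist_lt_edist_lt hφ (by positivity) hr hp
      have h1 := edist_leftTranslate (ip := ip) hφ z.coords z.coords p
      rw [leftTranslate_self] at h1
      have h2 := hbase (leftTranslate φ z.coords p) (h1.trans_lt hzp)
      refine ⟨(z.coords, leftTranslate φ z.coords p), ⟨hKp z.coords hz, h2⟩, ?_⟩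
      rw [leftTranslate_eq]
      ext <;> simp [flow_flow_neg]

theorem exists_isCompact_of_edist_le (hφ : IsSmoothFlow E φ)
    (ip : InnerProductSpace.Core ℝ (GroupLieAlgebra 𝓘(ℝ, E) N)) (R : ℝ≥0) :
    ∃ K : Set N, IsCompact K ∧ ∀ g,
      edist (Heintze.vertical (φ := φ) ip 1 0) (Heintze.vertical ip g 0) ≤ R → g ∈ K := by
  obtain ⟨r, hr, h⟩ := exists_isCompact_of_edist_lt hφ ip
  obtain ⟨k, hk⟩ := exists_nat_gt ((R : ℝ) / r)
  obtain ⟨K, hK, hKp⟩ := h k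
  refine ⟨Prod.fst '' K, hK.image continuous_fst, fun g hg => ⟨(g, 0), hKp (g, 0) ?_, rfl⟩⟩
  refine lt_of_le_of_lt hg ?_
  rw [← ENNReal.ofReal_coe_nnreal, ENNReal.ofReal_lt_ofReal_iff (by positivity)]
  rw [div_lt_iff₀ hr] at hk
  linarith

end

/-! ### Dynamics of the expanding flow on `N`. -/

noncomputable section

section Dynamics

variable {N : Type*} [TopologicalSpace N] [Group N] [IsTopologicalGroup N]
  [LocallyCompactSpace N] [T2Space N] {φ : Multiplicative ℝ →* MulAut N}

/-- Baire category: pointwise convergence covers `N` by the closed sets `A k`, so one of them has an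
interior point `u`, and dividing by `u` moves its interior to a neighbourhood of `1`. -/
theorem IsExpanding.exists_nhds_flow_mem (hexp : IsExpanding φ)
    (hc : ∀ t, Continuous (flow φ t)) {V : Set N} (hV : V ∈ 𝓝 1) :
    ∃ W ∈ 𝓝 (1 : N), ∃ T : ℝ, ∀ t ≥ T, ∀ g ∈ W, flow φ (-t) g ∈ V := by
  obtain ⟨V₁, hV₁, hdiv⟩ := exists_nhds_split_inv hV
  obtain ⟨V₂, hV₂, hcl, hsub⟩ := exists_mem_nhds_isClosed_subset hV₁
  let A : ℕ → Set N := fun k => {g | ∀ t : ℝ, k ≤ t → flow φ (-t) g ∈ V₂}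
  have hA : ∀ k, IsClosed (A k) := by
    intro k
    have : A k = ⋂ t : ℝ, ⋂ _ : k ≤ t, flow φ (-t) ⁻¹' V₂ := by ext; simp [A]
    rw [this]
    exact isClosed_iInter fun t => isClosed_iInter fun _ => hcl.preimage (hc _)
  have hU : ⋃ k, A k = univ := by
    refine eq_univ_of_forall fun g => ?_
    obtain ⟨T, hT⟩ := eventually_atTop.1 ((hexp g).eventually hV₂)
    obtain ⟨k, hk⟩ := exists_nat_ge T
    exact mem_iUnion.2 ⟨k, fun t ht => hT t (hk.trans ht)⟩
  obtain ⟨k, u, hu⟩ := nonempty_interior_of_iUnion_of_closed hA hU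
  refine ⟨(fun g => g * u) ⁻¹' interior (A k), ?_, k, fun t ht g hg => ?_⟩
  · refine (continuous_mul_const u).continuousAt.preimage_mem_nhds ?_
    rw [one_mul]
    exact isOpen_interior.mem_nhds hu
  · have h1 := interior_subset hg t ht
    have h2 := interior_subset hu t ht
    have h3 := hdiv _ (hsub h1) _ (hsub h2)
    rwa [← map_div, mul_div_cancel_right] at h3

/-- Near `x`, write `g = x * (x⁻¹ * g)`: the first factor converges to `1` by hypothesis, the second
uniformly by `exists_nhds_flow_mem`. -/
theorem IsExpanding.exists_flow_mem_of_isCompact (hexp : IsExpanding φ)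
    (hc : ∀ t, Continuous (flow φ t)) {K V : Set N} (hK : IsCompact K) (hV : V ∈ 𝓝 1) :
    ∃ T : ℝ, ∀ t ≥ T, ∀ g ∈ K, flow φ (-t) g ∈ V := by
  obtain ⟨V₁, hV₁, hmul⟩ := exists_nhds_one_split hV
  obtain ⟨W, hW, T, hT⟩ := hexp.exists_nhds_flow_mem hc hV₁
  refine hK.induction_on (p := fun s => ∃ T : ℝ, ∀ t ≥ T, ∀ g ∈ s, flow φ (-t) g ∈ V) ?_ ?_ ?_ ?_
  · exact ⟨0, by simp⟩
  · rintro s t hst ⟨T, hT⟩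
    exact ⟨T, fun u hu g hg => hT u hu g (hst hg)⟩
  · rintro s t ⟨T₁, h₁⟩ ⟨T₂, h₂⟩
    refine ⟨max T₁ T₂, fun u hu g hg => ?_⟩
    exact hg.elim (h₁ u ((le_max_left _ _).trans hu) g) (h₂ u ((le_max_right _ _).trans hu) g)
  · intro x _
    refine ⟨(fun g => x⁻¹ * g) ⁻¹' W, mem_nhdsWithin_of_mem_nhds ?_, ?_⟩
    · refine (continuous_const_mul x⁻¹).continuousAt.preimage_mem_nhds ?_
      rwa [inv_mul_cancel]
    · obtain ⟨T', hT'⟩ := eventually_atTop.1 ((hexp x).eventually hV₁)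
      refine ⟨max T T', fun t ht g hg => ?_⟩
      have h3 := hmul _ (hT' t ((le_max_right _ _).trans ht)) _
        (hT t ((le_max_left _ _).trans ht) _ hg)
      have h4 : flow φ (-t) x * flow φ (-t) (x⁻¹ * g) = flow φ (-t) g := by
        rw [← map_mul, mul_inv_cancel_left]
      rw [← h4]
      exact h3

/-- A compact neighbourhood `V` of `1` absorbs `V * V` after some time `S`, and so does `flow φ k ''
V`, since the automorphisms of the flow commute; a large `k` makes it contain `C`. That `S` is
independent of `C` matters: jumps over a time `S` are bounded in terms of `S`. -/
theorem IsExpanding.exists_absorbing (hexp : IsExpanding φ) (hc : ∀ t, Continuous (flow φ t)) :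
    ∃ S : ℝ, 0 < S ∧ ∀ C : Set N, IsCompact C → ∃ Q : Set N, IsCompact Q ∧ C ⊆ Q ∧ 1 ∈ Q ∧
      ∀ a ∈ Q, ∀ b ∈ Q, flow φ (-S) (a * b) ∈ Q := by
  obtain ⟨V, hV, hV1⟩ := exists_compact_mem_nhds (1 : N)
  obtain ⟨T, hT⟩ := hexp.exists_flow_mem_of_isCompact hc (hV.mul hV) hV1
  refine ⟨max T 1, by positivity, fun C hC => ?_⟩
  obtain ⟨k, hk⟩ := hexp.exists_flow_mem_of_isCompact hc hC hV1
  have himg : flow φ k '' V = {g | flow φ (-k) g ∈ V} := by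
    ext g
    refine ⟨?_, fun hg => ⟨_, hg, flow_flow_neg φ k g⟩⟩
    rintro ⟨v, hv, rfl⟩
    simpa [flow_neg_flow] using hv
  refine ⟨{g | flow φ (-k) g ∈ V}, himg ▸ hV.image (hc k), fun g hg => hk k le_rfl g hg, ?_, ?_⟩
  · simpa using mem_of_mem_nhds hV1
  · intro a ha b hb
    have := hT (max T 1) (le_max_left _ _) _ (mul_mem_mul ha hb)
    simp only [mem_ofPred_eq, ← map_mul, flow_flow] at this ⊢
    rwa [add_comm]

/-- Shadowing: a sequence of points of `N` whose successive quotients are bounded at the scales `n * S`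
stays within bounded distance of a point of `N`, at the same scales. -/
theorem exists_shadow (hc : ∀ t, Continuous (flow φ t)) {S : ℝ} {Q : Set N} (hQ : IsCompact Q)
    (hQ1 : 1 ∈ Q) (hQQ : ∀ a ∈ Q, ∀ b ∈ Q, flow φ (-S) (a * b) ∈ Q) (g : ℤ → N)
    (hg : ∀ n : ℤ, flow φ (-(n * S)) ((g n)⁻¹ * g (n + 1)) ∈ Q) :
    ∃ x : N, ∀ n : ℤ, flow φ (-(n * S)) (x⁻¹ * g n) ∈ Q := by
  -- Each further quotient is absorbed by one application of `flow φ (-S)`, so the bound does not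
  -- grow with `n - j`.
  have h1 : ∀ j n : ℤ, j ≤ n → flow φ (-(n * S)) ((g j)⁻¹ * g n) ∈ Q := by
    intro j n hjn
    induction n, hjn using Int.leInduction with
    | base => simpa using hQ1
    | succ n hn ih =>
      have h2 := hQQ _ ih _ (hg n)
      rw [← map_mul, flow_flow] at h2
      convert h2 using 2
      · push_cast; ring_nf
      · group
  let K : ℤ → Set N := fun n => {x | flow φ (-(n * S)) (x⁻¹ * g n) ∈ Q}
  have hKc : ∀ n, IsClosed (K n) := fun n =>
    hQ.isClosed.preimage ((hc _).comp (continuous_inv.mul continuous_const))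
  -- This compact set contains all `g j` with `j ≤ 0`. Their cluster point as `j → -∞` is the
  -- shadow, because the condition at level `n` is closed and holds for all `g j` with `j ≤ n`.
  have hK0 : IsCompact ((fun q => g 0 * (flow φ 0 q)⁻¹) '' Q) :=
    hQ.image (continuous_const.mul (hc _).inv)
  have hle : map g atBot ≤ 𝓟 ((fun q => g 0 * (flow φ 0 q)⁻¹) '' Q) := by
    rw [le_principal_iff, mem_map]
    filter_upwards [eventually_le_atBot (0 : ℤ)] with j hj
    refine ⟨_, h1 j 0 hj, ?_⟩
    simp [flow_zero]
  obtain ⟨x, -, hx⟩ := hK0 hle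
  refine ⟨x, fun n => ?_⟩
  refine isClosed_iff_clusterPt.1 (hKc n) x (hx.mono ?_)
  rw [le_principal_iff, mem_map]
  filter_upwards [eventually_le_atBot n] with j hj using h1 j n hj

end Dynamics

end

/-! ### Contracting families of curves and their parabolic distances. -/

noncomputable section

section ContractingFamily

theorem parabolicDist_self {A : Type*} [PseudoEMetricSpace A] (b : ℝ) (γ : ℝ → A) :
    parabolicDist b γ γ = 0 := by
  simp [parabolicDist]

variable {A ι : Type*} [PseudoEMetricSpace A]

/-- A family of curves, parametrized by height, which are uniformly contracting when the height
increases. -/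
structure IsContractingFamily (L : ι → ℝ → A) : Prop where
  edist_le : ∀ i s t, edist (L i s) (L i t) ≤ edist s t
  contracting : ∀ (R : ℝ≥0) (ε : ℝ≥0∞), 0 < ε → ∃ T : ℝ, 0 ≤ T ∧ ∀ i j t,
    edist (L i t) (L j t) ≤ R → ∀ s, t + T ≤ s → edist (L i s) (L j s) < ε
  near : ∀ i j, ∃ (t : ℝ) (R : ℝ≥0), edist (L i t) (L j t) ≤ R
  separated : ∀ i j, (∀ t, edist (L i t) (L j t) = 0) → i = j

namespace IsContractingFamily

variable {L : ι → ℝ → A} (hL : IsContractingFamily L)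
include hL

/-- Contraction started from far enough below makes the distance at any given height smaller than
any `ε`. -/
theorem eq_of_bounded {i j : ι} (R : ℝ≥0) (h : ∀ t ≤ 0, edist (L i t) (L j t) ≤ R) : i = j := by
  refine hL.separated i j fun t => ?_
  refine le_antisymm (le_of_forall_gt fun ε hε => ?_) zero_le
  obtain ⟨T, -, hT⟩ := hL.contracting R ε hε
  exact hT i j (min 0 (t - T)) (h _ (min_le_left _ _)) t (by linarith [min_le_right 0 (t - T)])

theorem continuous (i : ι) : Continuous (L i) :=
  (LipschitzWith.of_edist_le (hL.edist_le i)).continuous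

theorem exists_edist_eq_one {i j : ι} (hij : i ≠ j) : ∃ t, edist (L i t) (L j t) = 1 := by
  obtain ⟨t₁, R, h₁⟩ := hL.near i j
  obtain ⟨T, -, hT⟩ := hL.contracting R 1 one_pos
  have h2 := hT i j t₁ h₁ _ le_rfl
  obtain ⟨t₀, h0, h3⟩ : ∃ t ≤ (0 : ℝ), 1 < edist (L i t) (L j t) := by
    by_contra! hcon
    exact hij (hL.eq_of_bounded 1 (by simpa using hcon))
  have hc : Continuous fun t => edist (L i t) (L j t) := (hL.continuous i).edist (hL.continuous j)
  obtain ⟨t, ht⟩ := mem_range_of_exists_le_of_exists_ge (c := 1) hc ⟨_, h2.le⟩ ⟨t₀, h3.le⟩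
  exact ⟨t, ht⟩

theorem exists_parabolicDist_le (R : ℝ≥0) : ∃ T : ℝ, 0 ≤ T ∧ ∀ (b : ℝ), 1 < b → ∀ i j t,
    edist (L i t) (L j t) ≤ R → parabolicDist b (L i) (L j) ≤ b ^ (t + T) := by
  obtain ⟨T, hT0, hT⟩ := hL.contracting R 1 one_pos
  refine ⟨T, hT0, fun b hb i j t ht => ?_⟩
  have hb0 : 0 < b := one_pos.trans hb
  -- For an empty set, `sInf ∅ = 0` satisfies the bound.
  rcases ((fun t : ℝ => b ^ t) '' {t : ℝ | edist (L i t) (L j t) = 1}).eq_empty_or_nonempty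
    with he | ⟨_, s, hs, rfl⟩
  · rw [parabolicDist, he, Real.sInf_empty]
    positivity
  · have hbdd : BddBelow ((fun t : ℝ => b ^ t) '' {t : ℝ | edist (L i t) (L j t) = 1}) := by
      refine ⟨0, ?_⟩
      rintro _ ⟨u, -, rfl⟩
      positivity
    refine (csInf_le hbdd ⟨s, hs, rfl⟩).trans ?_
    · refine Real.rpow_le_rpow_of_exponent_le hb.le ?_
      by_contra! hlt
      exact (hT i j t ht s hlt.le).ne hs

theorem exists_le_parabolicDist {c : ℝ≥0∞} (hc : 0 < c) : ∃ T : ℝ, 0 ≤ T ∧ ∀ (b : ℝ), 1 < b →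
    ∀ i j t, c ≤ edist (L i t) (L j t) → i ≠ j → b ^ (t - T) ≤ parabolicDist b (L i) (L j) := by
  obtain ⟨T, hT0, hT⟩ := hL.contracting 1 c hc
  refine ⟨T, hT0, fun b hb i j t ht hij => ?_⟩
  obtain ⟨s, hs⟩ := hL.exists_edist_eq_one hij
  refine le_csInf ⟨_, s, hs, rfl⟩ ?_
  rintro _ ⟨u, hu, rfl⟩
  refine Real.rpow_le_rpow_of_exponent_le hb.le ?_
  by_contra! hlt
  exact ht.not_gt (hT i j u (by simpa using hu.le) t (by linarith))

/-- A map which distorts the separations of the lines of a contracting family in a coarsely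
Lipschitz way is bilipschitz, for all distances which compare to powers of the heights at which
lines are at distance `1`. -/
theorem isBilipschitz {F : ι → ι} {K C : ℝ≥0}
    (hF₁ : ∀ i j t, edist (L (F i) t) (L (F j) t) ≤ K * edist (L i t) (L j t) + C)
    (hF₂ : ∀ i j t, edist (L i t) (L j t) ≤ K * edist (L (F i) t) (L (F j) t) + C)
    {D : ι → ι → ℝ} {b T : ℝ} (hb : 1 < b) (hD0 : ∀ i, D i i = 0)
    (hD : ∀ i j t, i ≠ j → edist (L i t) (L j t) = 1 → b ^ (t - T) ≤ D i j ∧ D i j ≤ b ^ (t + T)) :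
    IsBilipschitz D F := by
  obtain ⟨T', hT'0, hT'⟩ := hL.contracting (K + C) 1 one_pos
  have hb0 : 0 < b := one_pos.trans hb
  -- `T` is lost twice in comparing `D` with powers of heights, and `T'` bounds the shift of the
  -- height at which the distance is `1`.
  refine ⟨b ^ (-(2 * T + T')), b ^ (2 * T + T'), by positivity, by positivity, fun i j => ?_⟩
  by_cases hij : i = j
  · subst hij; simp [hD0]
  have hFij : F i ≠ F j := by
    intro h
    refine hij (hL.eq_of_bounded C fun t _ => ?_)
    have := hF₂ i j t
    rwa [h, edist_self, mul_zero, zero_add] at this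
  obtain ⟨t, ht⟩ := hL.exists_edist_eq_one hij
  obtain ⟨s, hs⟩ := hL.exists_edist_eq_one hFij
  have h1 : s ≤ t + T' := by
    by_contra! hlt
    refine (hT' _ _ t ?_ s hlt.le).ne hs
    have := hF₁ i j t
    rwa [ht, mul_one, ← ENNReal.coe_add] at this
  have h2 : t ≤ s + T' := by
    by_contra! hlt
    refine (hT' _ _ s ?_ t hlt.le).ne ht
    have := hF₂ i j s
    rwa [hs, mul_one, ← ENNReal.coe_add] at this
  obtain ⟨h3, h4⟩ := hD i j t hij ht
  obtain ⟨h5, h6⟩ := hD _ _ s hFij hs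
  constructor
  · calc b ^ (-(2 * T + T')) * D i j ≤ b ^ (-(2 * T + T')) * b ^ (t + T) := by gcongr
      _ = b ^ (t - T - T') := by rw [← Real.rpow_add hb0]; ring_nf
      _ ≤ b ^ (s - T) := Real.rpow_le_rpow_of_exponent_le hb.le (by linarith)
      _ ≤ _ := h5
  · calc D (F i) (F j) ≤ b ^ (s + T) := h6
      _ ≤ b ^ (2 * T + T' + (t - T)) := Real.rpow_le_rpow_of_exponent_le hb.le (by linarith)
      _ = b ^ (2 * T + T') * b ^ (t - T) := Real.rpow_add hb0 _ _
      _ ≤ _ := by gcongr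

end IsContractingFamily

end ContractingFamily

/-! ### Contraction and shadowing for the vertical lines of `G_φ`. -/

section Heintze

variable {E : Type*} [NormedAddCommGroup E] [NormedSpace ℝ E] [FiniteDimensional ℝ E]
  {N : Type*} [TopologicalSpace N] [T2Space N] [ChartedSpace E N] [Group N]
  [LieGroup 𝓘(ℝ, E) ∞ N] {φ : Multiplicative ℝ →* MulAut N}
  (ip : InnerProductSpace.Core ℝ (GroupLieAlgebra 𝓘(ℝ, E) N))

theorem IsSmoothFlow.continuous (hφ : IsSmoothFlow E φ) (t : ℝ) : Continuous (flow φ t) :=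
  hφ.continuous_flow continuous_const continuous_id

include E in
variable (E N) in
theorem locallyCompactSpace_of_finiteDimensional : LocallyCompactSpace N := by
  have : ProperSpace E := FiniteDimensional.proper ℝ E
  exact ChartedSpace.locallyCompactSpace E N

theorem edist_vertical_le_of_height_le (hφ : IsSmoothFlow E φ) (g g' : N) {s t : ℝ} (hst : s ≤ t) :
    edist (Heintze.vertical (φ := φ) ip g s) (Heintze.vertical (φ := φ) ip g' s) ≤
      ENNReal.ofReal (2 * (t - s)) +
        edist (Heintze.vertical (φ := φ) ip g t) (Heintze.vertical (φ := φ) ip g' t) := by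
  refine (edist_triangle4 _ (Heintze.vertical ip g t) (Heintze.vertical ip g' t) _).trans ?_
  rw [edist_vertical hφ, edist_vertical hφ, edist_comm t s, edist_comm s t, edist_dist,
    Real.dist_eq, abs_of_nonneg (sub_nonneg.2 hst), two_mul,
    ENNReal.ofReal_add (sub_nonneg.2 hst) (sub_nonneg.2 hst)]
  exact le_of_eq (by ring)

/-- Go up until the flow has brought `K` close to `1`, cross over, and come down again. In
particular these distances are finite. -/
theorem exists_edist_le_of_isCompact (hφ : IsSmoothFlow E φ) (hexp : IsExpanding φ) {K : Set N}
    (hK : IsCompact K) : ∃ R : ℝ≥0, ∀ g ∈ K,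
      edist (Heintze.vertical (φ := φ) ip 1 0) (Heintze.vertical ip g 0) ≤ R := by
  have : IsTopologicalGroup N := topologicalGroup_of_lieGroup 𝓘(ℝ, E) ∞
  have := locallyCompactSpace_of_finiteDimensional E N
  obtain ⟨T, hT⟩ := hexp.exists_flow_mem_of_isCompact hφ.continuous hK
    (eventually_edist_vertical_lt (φ := φ) ip hφ one_pos)
  refine ⟨Real.toNNReal (2 * max T 0) + 1, fun g hg => ?_⟩
  have h1 := edist_vertical_le_of_height_le (φ := φ) ip hφ 1 g (le_max_right T 0)
  have h2 := hT (max T 0) (le_max_left _ _) g hg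
  rw [edist_vertical_same_height hφ 1 g (max T 0), inv_one, one_mul, sub_zero] at h1
  refine h1.trans ?_
  rw [ENNReal.coe_add]
  exact add_le_add le_rfl (le_of_lt h2)

theorem isContractingFamily_vertical (hφ : IsSmoothFlow E φ) (hexp : IsExpanding φ) :
    IsContractingFamily (Heintze.vertical (φ := φ) ip) := by
  have : IsTopologicalGroup N := topologicalGroup_of_lieGroup 𝓘(ℝ, E) ∞
  have := locallyCompactSpace_of_finiteDimensional E N
  refine ⟨fun g s t => edist_vertical_le hφ g s t, fun R ε hε => ?_, fun g g' => ?_,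
    fun g g' h => ?_⟩
  · obtain ⟨K, hK, hKR⟩ := exists_isCompact_of_edist_le hφ ip R
    obtain ⟨T, hT⟩ := hexp.exists_flow_mem_of_isCompact hφ.continuous hK
      (eventually_edist_vertical_lt (φ := φ) ip hφ hε)
    refine ⟨max T 0, le_max_right _ _, fun g g' t ht s hs => ?_⟩
    rw [edist_vertical_same_height hφ] at ht ⊢
    have := hT (s - t) (by linarith [le_max_left T 0]) _ (hKR _ ht)
    rw [flow_flow, show -(s - t) + -t = -s by ring] at this
    exact this
  · obtain ⟨R, hR⟩ := exists_edist_le_of_isCompact ip hφ hexp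
      (isCompact_singleton (x := g⁻¹ * g'))
    refine ⟨0, R, ?_⟩
    rw [edist_vertical_same_height hφ, neg_zero, flow_zero]
    exact hR _ rfl
  · have h0 := h 0
    rw [edist_vertical_same_height hφ, neg_zero, flow_zero] at h0
    exact inv_mul_eq_one.1 (eq_one_of_edist_le (t := 0) hφ ip (h0.le.trans zero_le))

theorem exists_shadow_vertical (hφ : IsSmoothFlow E φ) (hexp : IsExpanding φ) :
    ∃ S : ℝ, 0 < S ∧ ∀ R : ℝ≥0, ∃ R' : ℝ≥0, ∀ g : ℤ → N,
      (∀ n : ℤ, edist (Heintze.vertical (φ := φ) ip (g n) (n * S))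
        (Heintze.vertical ip (g (n + 1)) (n * S)) ≤ R) →
      ∃ x, ∀ n : ℤ, edist (Heintze.vertical (φ := φ) ip x (n * S))
        (Heintze.vertical ip (g n) (n * S)) ≤ R' := by
  have : IsTopologicalGroup N := topologicalGroup_of_lieGroup 𝓘(ℝ, E) ∞
  have := locallyCompactSpace_of_finiteDimensional E N
  obtain ⟨S, hS, h⟩ := hexp.exists_absorbing hφ.continuous
  refine ⟨S, hS, fun R => ?_⟩
  obtain ⟨K, hK, hKR⟩ := exists_isCompact_of_edist_le hφ ip R
  obtain ⟨Q, hQ, hKQ, hQ1, hQQ⟩ := h K hK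
  obtain ⟨R', hR'⟩ := exists_edist_le_of_isCompact ip hφ hexp hQ
  refine ⟨R', fun g hg => ?_⟩
  obtain ⟨x, hx⟩ := exists_shadow hφ.continuous hQ hQ1 hQQ g fun n => hKQ (hKR _ (by
    have := hg n
    rwa [edist_vertical_same_height hφ] at this))
  refine ⟨x, fun n => ?_⟩
  rw [edist_vertical_same_height hφ]
  exact hR' _ (hx n)

end Heintze

end

/-! ### Lines of the tree and the `m`-adic metric. -/

noncomputable section

namespace TreePoint

variable {m : ℕ} [NeZero m]

theorem dist_eq (p q : TreePoint m) :
    dist p q = (meetHeight p q - p.height) + (meetHeight p q - q.height) := rfl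

theorem abs_height_sub_le_dist (p q : TreePoint m) : |p.height - q.height| ≤ dist p q := by
  have h := meetHeight_mem p q
  rw [dist_eq, abs_le]
  constructor <;> linarith [h.1, h.2.1]

theorem edist_height_le (p q : TreePoint m) : edist p.height q.height ≤ edist p q := by
  rw [edist_dist, edist_dist, Real.dist_eq]
  exact ENNReal.ofReal_le_ofReal (abs_height_sub_le_dist p q)

/-- The `m`-adic number whose digits are those of a point of the tree. -/
def toMAdic (p : TreePoint m) : MAdic m := ⟨p.digit, p.eventually_zero⟩

theorem ofMAdic_toMAdic (p : TreePoint m) : ofMAdic p.toMAdic p.height = p := by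
  refine TreePoint.ext rfl (funext fun i => ?_)
  simp only [ofMAdic, toMAdic]
  split_ifs with h
  · rfl
  · exact (p.digit_eq_zero i (not_lt.1 h)).symm

theorem ofMAdic_eq_ofMAdic {x y : MAdic m} {t : ℝ}
    (h : ∀ i < -⌊t⌋, x.digit i = y.digit i) : ofMAdic x t = ofMAdic y t := by
  refine TreePoint.ext rfl (funext fun i => ?_)
  simp only [ofMAdic]
  split_ifs with hi
  · exact h i hi
  · rfl

/-- The upward rays of two points at distance at most `R` have met by height `s + R`, where the
digits still present agree. -/
theorem digit_eq_of_dist_le {x y : MAdic m} {s t R : ℝ}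
    (h : dist (ofMAdic x s) (ofMAdic y t) ≤ R) : ∀ i < -⌊s + R⌋, x.digit i = y.digit i := by
  intro i hi
  have h1 := meetHeight_mem (ofMAdic x s) (ofMAdic y t)
  rw [dist_eq] at h
  set u := meetHeight (ofMAdic x s) (ofMAdic y t)
  have hs : s ≤ u := h1.1
  have ht : t ≤ u := h1.2.1
  have hu : u ≤ s + R := by
    have : (u - s) + (u - t) ≤ R := h
    linarith
  have h2 := Int.floor_le_floor hs
  have h3 := Int.floor_le_floor ht
  have h4 := Int.floor_le_floor hu
  have h5 := h1.2.2 i (by omega)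
  simp only [ofMAdic] at h5
  rwa [if_pos (by omega), if_pos (by omega)] at h5

theorem ofMAdic_eq_of_dist_le {x y : MAdic m} {s t R u : ℝ}
    (h : dist (ofMAdic x s) (ofMAdic y t) ≤ R) (hu : s + R ≤ u) : ofMAdic x u = ofMAdic y u :=
  ofMAdic_eq_ofMAdic fun i hi => digit_eq_of_dist_le h i (by
    have := Int.floor_le_floor hu
    omega)

theorem dist_ofMAdic_le (x : MAdic m) (s t : ℝ) : dist (ofMAdic x s) (ofMAdic x t) ≤ |s - t| := by
  have h : max s t ∈ meetSet (ofMAdic x s) (ofMAdic x t) := by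
    refine ⟨le_max_left _ _, le_max_right _ _, fun i hi => ?_⟩
    have h1 := Int.floor_le_floor (le_max_left s t)
    have h2 := Int.floor_le_floor (le_max_right s t)
    simp only [ofMAdic]
    rw [if_pos (by omega), if_pos (by omega)]
  have h1 := meetHeight_le h
  rw [dist_eq]
  change (_ - s) + (_ - t) ≤ _
  rcases le_total s t with hst | hst
  · rw [max_eq_right hst] at h1
    rw [abs_of_nonpos (sub_nonpos.2 hst)]
    linarith
  · rw [max_eq_left hst] at h1
    rw [abs_of_nonneg (sub_nonneg.2 hst)]
    linarith

theorem edist_ofMAdic_le (x : MAdic m) (s t : ℝ) :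
    edist (ofMAdic x s) (ofMAdic x t) ≤ edist s t := by
  rw [edist_dist, edist_dist, Real.dist_eq]
  exact ENNReal.ofReal_le_ofReal (dist_ofMAdic_le x s t)

theorem eq_of_ofMAdic_eq {x y : MAdic m} (h : ∀ t, ofMAdic x t = ofMAdic y t) : x = y := by
  refine MAdic.ext (funext fun i => ?_)
  have h1 := congrArg (fun p => p.digit i) (h ((-i - 1 : ℤ) : ℝ))
  simp only [ofMAdic, Int.floor_intCast] at h1
  rwa [if_pos (by omega), if_pos (by omega)] at h1

theorem isContractingFamily_ofMAdic : IsContractingFamily (ofMAdic (m := m)) where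
  edist_le := edist_ofMAdic_le
  contracting R ε hε := by
    refine ⟨R, R.2, fun x y t ht s hs => ?_⟩
    rw [edist_le_coe, ← NNReal.coe_le_coe, coe_nndist] at ht
    rw [ofMAdic_eq_of_dist_le ht hs, edist_self]
    exact hε
  near x y := ⟨0, nndist (ofMAdic x 0) (ofMAdic y 0), (edist_nndist _ _).le⟩
  separated x y h := eq_of_ofMAdic_eq fun t => edist_eq_zero.1 (h t)

end TreePoint

namespace MAdic

variable {m : ℕ} [NeZero m]

theorem bddBelow_dist (x y : MAdic m) :
    BddBelow ((fun k : ℤ => (m : ℝ) ^ (-k)) '' {k | ∀ i < k, x.digit i = y.digit i}) := by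
  refine ⟨0, ?_⟩
  rintro _ ⟨k, -, rfl⟩
  positivity

theorem dist_le (hm : 2 ≤ m) {x y : MAdic m} {t R : ℝ}
    (h : Dist.dist (TreePoint.ofMAdic x t) (TreePoint.ofMAdic y t) ≤ R) :
    MAdic.dist x y ≤ (m : ℝ) ^ (t + R) := by
  have hm1 : (1 : ℝ) ≤ m := by exact_mod_cast one_le_two.trans hm
  refine (csInf_le (bddBelow_dist x y) ⟨-⌊t + R⌋, TreePoint.digit_eq_of_dist_le h, rfl⟩).trans ?_
  simp only [neg_neg]
  rw [← Real.rpow_intCast]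
  exact Real.rpow_le_rpow_of_exponent_le hm1 (Int.floor_le _)

theorem le_dist (hm : 2 ≤ m) {x y : MAdic m} {t : ℝ}
    (h : TreePoint.ofMAdic x t ≠ TreePoint.ofMAdic y t) :
    (m : ℝ) ^ t ≤ MAdic.dist x y := by
  have hm1 : (1 : ℝ) ≤ m := by exact_mod_cast one_le_two.trans hm
  refine le_csInf ?_ ?_
  · obtain ⟨k, hk⟩ := x.eventually_zero
    obtain ⟨l, hl⟩ := y.eventually_zero
    refine ⟨_, min k l, fun i hi => ?_, rfl⟩
    rw [hk i (hi.trans_le (min_le_left _ _)), hl i (hi.trans_le (min_le_right _ _))]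
  · rintro _ ⟨k, hk, rfl⟩
    simp only
    rw [← Real.rpow_intCast]
    refine Real.rpow_le_rpow_of_exponent_le hm1 ?_
    by_contra! hlt
    refine h (TreePoint.ofMAdic_eq_ofMAdic fun i hi => hk i ?_)
    have := Int.le_floor.2 hlt.le
    omega

theorem dist_self (hm : 2 ≤ m) (x : MAdic m) : MAdic.dist x x = 0 := by
  have hm1 : (1 : ℝ) < m := by exact_mod_cast one_lt_two.trans_le hm
  refine le_antisymm (le_of_forall_pos_le_add fun ε hε => ?_) ?_
  · rw [zero_add]
    obtain ⟨k, hk⟩ := exists_pow_lt_of_lt_one hε (inv_lt_one_of_one_lt₀ hm1)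
    refine (csInf_le (bddBelow_dist x x) ⟨k, fun _ _ => rfl, rfl⟩).trans ?_
    simpa using hk.le
  · refine Real.sInf_nonneg ?_
    rintro _ ⟨k, -, rfl⟩
    positivity

end MAdic

end

/-! ### The path metric of `X` compared with those of its factors. -/

noncomputable section

theorem pathEDist_real_le (s t : ℝ) : pathEDist s t ≤ edist s t := by
  wlog hst : s ≤ t generalizing s t
  · rw [pathEDist_comm, edist_comm]
    exact this t s (le_of_not_ge hst)
  let γ : Path s t :=
    { toFun := fun u => s + u * (t - s)
      continuous_toFun := by fun_prop
      source' := by simp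
      target' := by simp }
  refine iInf_le_of_le γ ?_
  have hmono : MonotoneOn γ univ := by
    intro u _ v _ huv
    change s + u * (t - s) ≤ s + v * (t - s)
    have : (u : ℝ) ≤ v := huv
    have h2 : 0 ≤ t - s := sub_nonneg.2 hst
    gcongr
  have h := hmono.eVariationOn_eq (mem_univ 0) (mem_univ 1)
  rw [γ.source, γ.target, show Icc (0 : unitInterval) 1 = univ from eq_univ_of_forall
    fun u => ⟨bot_le, le_top⟩, inter_univ] at h
  rw [edist_comm, edist_dist, Real.dist_eq, abs_of_nonneg (sub_nonneg.2 hst)]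
  exact h.le

theorem pathEDist_map_le {A B : Type*} [PseudoEMetricSpace A] [PseudoEMetricSpace B] {j : A → B}
    {K : ℝ≥0} (hK : K ≠ 0) (hj : LipschitzWith K j) (p q : A) :
    pathEDist (j p) (j q) ≤ K * pathEDist p q := by
  rw [pathEDist, pathEDist, ENNReal.mul_iInf_of_ne (by simpa using hK) ENNReal.coe_ne_top]
  · refine le_iInf fun γ => iInf_le_of_le (γ.map hj.continuous) ?_
    exact (hj.lipschitzOnWith (s := univ)).comp_eVariationOn_le (mapsTo_univ _ _)

theorem edist_le_pathEDist {A : Type*} [PseudoEMetricSpace A] (p q : A) :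
    edist p q ≤ pathEDist p q := by
  refine le_iInf fun γ => ?_
  have := eVariationOn.edist_le γ (mem_univ 0) (mem_univ 1)
  rwa [γ.source, γ.target] at this

theorem le_of_sq_le_sq {a b : ℝ≥0∞} (h : a ^ 2 ≤ b ^ 2) : a ≤ b :=
  (ENNReal.pow_right_strictMono two_ne_zero).le_iff_le.1 h

theorem edist_withLp_sq {A B : Type*} [PseudoEMetricSpace A] [PseudoEMetricSpace B]
    (p q : WithLp 2 (A × B)) :
    edist p q ^ 2 = edist p.fst q.fst ^ 2 + edist p.snd q.snd ^ 2 := by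
  rw [WithLp.prod_edist_eq_add (by simp)]
  simp only [ENNReal.toReal_ofNat, ENNReal.rpow_ofNat]
  rw [← ENNReal.rpow_ofNat, ← ENNReal.rpow_mul]
  simp

theorem ofReal_inv_sqrt_two_sq : 2 * ENNReal.ofReal (1 / √2) ^ 2 = 1 := by
  rw [← ENNReal.ofReal_pow (by positivity), div_pow, Real.sq_sqrt zero_le_two,
    ← ENNReal.ofReal_ofNat 2, ← ENNReal.ofReal_mul zero_le_two]
  norm_num

section Space

variable {E : Type*} [NormedAddCommGroup E] [NormedSpace ℝ E]
  {N : Type*} [TopologicalSpace N] [ChartedSpace E N] [Group N]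
  {φ : Multiplicative ℝ →* MulAut N}
  {ip : InnerProductSpace.Core ℝ (GroupLieAlgebra 𝓘(ℝ, E) N)}
  {m : ℕ} [NeZero m]

namespace Space

theorem edist_def (p q : Space φ ip m) :
    edist p q = ENNReal.ofReal (1 / √2) * pathEDist p.toProd q.toProd := rfl

theorem edist_sq_add_le (p q : Space φ ip m) :
    edist p.fst q.fst ^ 2 + edist p.snd q.snd ^ 2 ≤ 2 * edist p q ^ 2 := by
  rw [edist_def, mul_pow, ← mul_assoc, ofReal_inv_sqrt_two_sq, one_mul]
  refine (edist_withLp_sq p.toProd.1 q.toProd.1).symm.le.trans ?_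
  exact pow_le_pow_left' (edist_le_pathEDist p.toProd q.toProd) 2

theorem edist_fst_le (p q : Space φ ip m) : edist p.fst q.fst ≤ 2 * edist p q := by
  have h := le_self_add.trans (edist_sq_add_le p q)
  refine le_of_sq_le_sq ?_
  rw [mul_pow]
  refine h.trans ?_
  gcongr
  norm_num

theorem edist_snd_le (p q : Space φ ip m) : edist p.snd q.snd ≤ 2 * edist p q := by
  have h := le_add_self.trans (edist_sq_add_le p q)
  refine le_of_sq_le_sq ?_
  rw [mul_pow]
  refine h.trans ?_
  gcongr
  norm_num

theorem snd_height (p : Space φ ip m) : p.snd.height = p.height := p.toProd.2.symm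

/-- With both components `1`-Lipschitz, `j` is `√2`-Lipschitz into the `ℓ²` product, and the
rescaling by `1 / √2` removes the factor. The bound is by `pathEDist` because the metric of `X`
measures lengths of paths, and those are what `j` transports. -/
theorem edist_le_pathEDist_of_le {B : Type*} [PseudoEMetricSpace B] {j : B → Space φ ip m}
    (h₁ : ∀ b b', edist (j b).fst (j b').fst ≤ edist b b')
    (h₂ : ∀ b b', edist (j b).snd (j b').snd ≤ edist b b') (b b' : B) :
    edist (j b) (j b') ≤ pathEDist b b' := by
  have hsq : ((NNReal.sqrt 2 : ℝ≥0) : ℝ≥0∞) ^ 2 = 2 := by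
    rw [← ENNReal.coe_pow, NNReal.sq_sqrt]; rfl
  have hj : LipschitzWith (NNReal.sqrt 2) (fun b => (j b).toProd) := by
    intro b b'
    refine le_of_sq_le_sq ?_
    rw [mul_pow, hsq]
    refine (edist_withLp_sq (j b).toProd.1 (j b').toProd.1).le.trans ?_
    rw [two_mul]
    exact add_le_add (pow_le_pow_left' (h₁ b b') 2) (pow_le_pow_left' (h₂ b b') 2)
  rw [edist_def]
  calc ENNReal.ofReal (1 / √2) * pathEDist (j b).toProd (j b').toProd
      ≤ ENNReal.ofReal (1 / √2) * ((NNReal.sqrt 2 : ℝ≥0) * pathEDist b b') := by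
        gcongr
        exact pathEDist_map_le (by simp) hj b b'
    _ = pathEDist b b' := by
        rw [← mul_assoc]
        have h3 : (ENNReal.ofReal (1 / √2) * (NNReal.sqrt 2 : ℝ≥0)) ^ 2 = 1 ^ 2 := by
          rw [mul_pow, hsq, mul_comm, ofReal_inv_sqrt_two_sq, one_pow]
        rw [(ENNReal.pow_right_strictMono two_ne_zero).injective h3, one_mul]

theorem vertical_toMAdic (p : Space φ ip m) :
    vertical (p.fst.coords.1, p.snd.toMAdic) p.height = p := by
  obtain ⟨⟨⟨a, b⟩, h⟩⟩ := p
  have h' : a.height = b.height := h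
  simp only [vertical, fst, snd, height, mk.injEq, Subtype.mk.injEq]
  congr 2
  refine Eq.trans ?_ b.ofMAdic_toMAdic
  exact congrArg _ h'

variable [LieGroup 𝓘(ℝ, E) ∞ N]

theorem edist_height_le (hφ : IsSmoothFlow E φ) (p q : Space φ ip m) :
    edist p.height q.height ≤ edist p q := by
  have h₁ := Millefeuille.edist_height_le hφ p.fst q.fst
  have h₂ := TreePoint.edist_height_le p.snd q.snd
  rw [snd_height, snd_height] at h₂
  have h := (add_le_add (pow_le_pow_left' h₁ 2) (pow_le_pow_left' h₂ 2)).trans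
    (edist_sq_add_le p q)
  have h' : 2 * edist p.height q.height ^ 2 ≤ 2 * edist p q ^ 2 := by
    rw [two_mul]; exact h
  refine le_of_sq_le_sq ?_
  exact (ENNReal.mul_le_mul_iff_right two_ne_zero ENNReal.ofNat_ne_top).1 h'

theorem edist_vertical (hφ : IsSmoothFlow E φ) (ξ : N × MAdic m) (s t : ℝ) :
    edist (vertical (φ := φ) (ip := ip) ξ s) (vertical ξ t) = edist s t := by
  refine le_antisymm ?_ (edist_height_le hφ (vertical (φ := φ) (ip := ip) ξ s) (vertical ξ t))
  refine (edist_le_pathEDist_of_le (j := vertical (φ := φ) (ip := ip) ξ)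
    (fun s t => edist_vertical_le hφ ξ.1 s t)
    (fun s t => TreePoint.edist_ofMAdic_le ξ.2 s t) s t).trans (pathEDist_real_le s t)

variable [FiniteDimensional ℝ E]

/-- The line `ℓ_x` gives a section `p ↦ (p, ℓ_x(h(p)))` of `X → G_φ`, whose tree component is
`1`-Lipschitz because the height is. -/
theorem edist_vertical_left_le (hφ : IsSmoothFlow E φ) (g g' : N) (x : MAdic m) (t : ℝ) :
    edist (vertical (φ := φ) (ip := ip) (g, x) t) (vertical (g', x) t) ≤
      edist (Heintze.vertical (φ := φ) ip g t) (Heintze.vertical ip g' t) := by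
  let j : Heintze φ ip → Space φ ip m := fun p => vertical (p.coords.1, x) p.height
  have h := edist_le_pathEDist_of_le (j := j) (fun p q => le_rfl)
    (fun p q => (TreePoint.edist_ofMAdic_le x _ _).trans (Millefeuille.edist_height_le hφ p q))
    (Heintze.vertical ip g t) (Heintze.vertical ip g' t)
  exact h.trans (pathEDist_le_edist hφ _ _)

omit [FiniteDimensional ℝ E] in
-- Go up the first line to the height `u` where the tree lines meet, and down the second; this costs
-- `2 * (u - t)`, the distance in the tree.
theorem edist_vertical_right_le (hφ : IsSmoothFlow E φ) (g : N) (x x' : MAdic m) (t : ℝ) :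
    edist (vertical (φ := φ) (ip := ip) (g, x) t) (vertical (g, x') t) ≤
      edist (TreePoint.ofMAdic x t) (TreePoint.ofMAdic x' t) := by
  set R := dist (TreePoint.ofMAdic x t) (TreePoint.ofMAdic x' t) with hR
  set u := TreePoint.meetHeight (TreePoint.ofMAdic x t) (TreePoint.ofMAdic x' t) with hu
  have hmem := TreePoint.meetHeight_mem (TreePoint.ofMAdic x t) (TreePoint.ofMAdic x' t)
  have htu : t ≤ u := hmem.1
  have hRu : R = (u - t) + (u - t) := rfl
  have hx : TreePoint.ofMAdic x u = TreePoint.ofMAdic x' u := by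
    refine TreePoint.ofMAdic_eq_ofMAdic fun i hi => ?_
    have h1 := hmem.2.2 i hi
    have h2 := Int.floor_le_floor htu
    simp only [TreePoint.ofMAdic] at h1
    rwa [if_pos (by omega), if_pos (by omega)] at h1
  have hv : vertical (φ := φ) (ip := ip) (g, x) u = vertical (g, x') u := by
    simp only [vertical, hx]
  refine (edist_triangle _ (vertical (φ := φ) (ip := ip) (g, x) u) _).trans ?_
  rw [edist_vertical hφ, hv, edist_vertical hφ, edist_dist, edist_dist, edist_dist, Real.dist_eq,
    Real.dist_eq, abs_of_nonneg (sub_nonneg.2 htu), abs_of_nonpos (sub_nonpos.2 htu), neg_sub,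
    ← ENNReal.ofReal_add (sub_nonneg.2 htu) (sub_nonneg.2 htu), ← hR, hRu]

theorem edist_vertical_le_add (hφ : IsSmoothFlow E φ) (ξ η : N × MAdic m) (t : ℝ) :
    edist (vertical (φ := φ) (ip := ip) ξ t) (vertical η t) ≤
      edist (Heintze.vertical (φ := φ) ip ξ.1 t) (Heintze.vertical ip η.1 t) +
        edist (TreePoint.ofMAdic ξ.2 t) (TreePoint.ofMAdic η.2 t) :=
  (edist_triangle _ (vertical (η.1, ξ.2) t) _).trans
    (add_le_add (edist_vertical_left_le hφ ξ.1 η.1 ξ.2 t)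
      (edist_vertical_right_le hφ η.1 ξ.2 η.2 t))

variable [T2Space N] (ip)

theorem isContractingFamily_vertical (hφ : IsSmoothFlow E φ) (hexp : IsExpanding φ) :
    IsContractingFamily (vertical (φ := φ) (ip := ip) (m := m)) := by
  have hG := Millefeuille.isContractingFamily_vertical ip hφ hexp
  have hT := TreePoint.isContractingFamily_ofMAdic (m := m)
  have hfst : ∀ (ξ η : N × MAdic m) (t : ℝ),
      edist (Heintze.vertical (φ := φ) ip ξ.1 t) (Heintze.vertical ip η.1 t) ≤
        2 * edist (vertical (φ := φ) (ip := ip) ξ t) (vertical η t) := fun ξ η t =>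
    edist_fst_le (vertical (φ := φ) (ip := ip) ξ t) (vertical η t)
  have hsnd : ∀ (ξ η : N × MAdic m) (t : ℝ),
      edist (TreePoint.ofMAdic ξ.2 t) (TreePoint.ofMAdic η.2 t) ≤
        2 * edist (vertical (φ := φ) (ip := ip) ξ t) (vertical η t) := fun ξ η t =>
    edist_snd_le (vertical (φ := φ) (ip := ip) ξ t) (vertical η t)
  refine ⟨fun ξ s t => (edist_vertical hφ ξ s t).le, fun R ε hε => ?_, fun ξ η => ?_,
    fun ξ η h => ?_⟩
  · obtain ⟨T₁, h₁, h₁'⟩ := hG.contracting (2 * R) (ε / 2) (ENNReal.half_pos hε.ne')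
    obtain ⟨T₂, h₂, h₂'⟩ := hT.contracting (2 * R) (ε / 2) (ENNReal.half_pos hε.ne')
    refine ⟨max T₁ T₂, h₁.trans (le_max_left _ _), fun ξ η t ht s hs => ?_⟩
    have h2R : 2 * edist (vertical (φ := φ) (ip := ip) ξ t) (vertical η t) ≤ (2 * R : ℝ≥0) := by
      push_cast
      gcongr
    refine (edist_vertical_le_add hφ ξ η s).trans_lt ?_
    rw [← ENNReal.add_halves ε]
    exact ENNReal.add_lt_add
      (h₁' _ _ t ((hfst ξ η t).trans h2R) s (by linarith [le_max_left T₁ T₂]))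
      (h₂' _ _ t ((hsnd ξ η t).trans h2R) s (by linarith [le_max_right T₁ T₂]))
  · obtain ⟨t, R, h⟩ := hG.near ξ.1 η.1
    refine ⟨t, R + nndist (TreePoint.ofMAdic ξ.2 t) (TreePoint.ofMAdic η.2 t), ?_⟩
    rw [ENNReal.coe_add, ← edist_nndist]
    exact (edist_vertical_le_add hφ ξ η t).trans (by gcongr)
  · refine Prod.ext (hG.separated _ _ fun t => ?_) (hT.separated _ _ fun t => ?_)
    · simpa [h t] using hfst ξ η t
    · simpa [h t] using hsnd ξ η t

end Space

end Space

end

/-! ### Vertical geodesics of `X`, and shadowing by them. -/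

noncomputable section

namespace TreePoint

variable {m : ℕ} [NeZero m]

theorem dist_ofMAdic_le_of_digit_eq {x y : MAdic m} {t : ℝ} (R : ℝ≥0)
    (h : ∀ i < -⌊t + R⌋, x.digit i = y.digit i) : dist (ofMAdic x t) (ofMAdic y t) ≤ 2 * R := by
  have hmem : t + R ∈ meetSet (ofMAdic x t) (ofMAdic y t) := by
    refine ⟨le_add_of_nonneg_right R.2, le_add_of_nonneg_right R.2, fun i hi => ?_⟩
    simp only [ofMAdic]
    rw [h i hi]
  have h1 := meetHeight_le hmem
  rw [dist_eq]
  change (_ - t) + (_ - t) ≤ _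
  linarith

theorem exists_shadow_ofMAdic {S : ℝ} (hS : 0 < S) (R : ℝ) (x : ℤ → MAdic m)
    (hx : ∀ n : ℤ, ∀ i < -⌊n * S + R⌋, (x n).digit i = (x (n + 1)).digit i) :
    ∃ y : MAdic m, ∀ n : ℤ, ∀ i < -⌊n * S + R⌋, y.digit i = (x n).digit i := by
  have hmono : ∀ j n : ℤ, j ≤ n → -⌊n * S + R⌋ ≤ -⌊j * S + R⌋ := by
    intro j n hjn
    refine neg_le_neg (Int.floor_le_floor ?_)
    have : (j : ℝ) ≤ n := by exact_mod_cast hjn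
    gcongr
  have h1 : ∀ j n : ℤ, j ≤ n → ∀ i < -⌊n * S + R⌋, (x j).digit i = (x n).digit i := by
    intro j n hjn
    induction n, hjn using Int.leInduction with
    | base => intro i _; rfl
    | succ n hn ih =>
      intro i hi
      have hi' := hi.trans_le (hmono n (n + 1) (by omega))
      rw [ih i hi', hx n i hi']
  have h2 : ∀ j n i : ℤ, i < -⌊j * S + R⌋ → i < -⌊n * S + R⌋ →
      (x j).digit i = (x n).digit i := by
    intro j n i hj hn
    rcases le_total j n with h | h
    · exact h1 j n h i hn
    · exact (h1 n j h i hj).symm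
  have h3 : ∀ i : ℤ, ∃ k : ℤ, i < -⌊k * S + R⌋ := by
    intro i
    -- This is the largest `k` with `k * S + R ≤ -i - 1`, a height at which the digit `i` is still
    -- present.
    refine ⟨⌊(-i - 1 - R) / S⌋, ?_⟩
    have h4 := Int.floor_le ((-i - 1 - R) / S)
    rw [le_div_iff₀ hS] at h4
    have h5 : ⌊(⌊(-i - 1 - R) / S⌋ : ℝ) * S + R⌋ ≤ ⌊((-i - 1 : ℤ) : ℝ)⌋ :=
      Int.floor_le_floor (by push_cast; linarith)
    rw [Int.floor_intCast] at h5
    omega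
  choose k hk using h3
  obtain ⟨l, hl⟩ := (x 0).eventually_zero
  refine ⟨⟨fun i => (x (k i)).digit i, min l (-⌊(0 : ℤ) * S + R⌋), fun i hi => ?_⟩,
    fun n i hi => h2 _ _ i (hk i) hi⟩
  rw [h2 _ 0 i (hk i) (hi.trans_le (min_le_right _ _)), hl i (hi.trans_le (min_le_left _ _))]

theorem exists_eq_ofMAdic (x : ℝ → MAdic m)
    (hx : ∀ s t, dist (ofMAdic (x s) s) (ofMAdic (x t) t) ≤ |s - t|) :
    ∃ y : MAdic m, ∀ t, ofMAdic (x t) t = ofMAdic y t := by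
  have h1 : ∀ s t, s ≤ t → ∀ i < -⌊t⌋, (x s).digit i = (x t).digit i := by
    intro s t hst i hi
    refine digit_eq_of_dist_le (hx s t) i ?_
    rwa [abs_of_nonpos (sub_nonpos.2 hst), neg_sub, add_sub_cancel]
  have h2 : ∀ s t (i : ℤ), i < -⌊s⌋ → i < -⌊t⌋ → (x s).digit i = (x t).digit i := by
    intro s t i hs ht
    rcases le_total s t with h | h
    · exact h1 s t h i ht
    · exact (h1 t s h i hs).symm
  obtain ⟨l, hl⟩ := (x 0).eventually_zero
  -- The digit `i` is read at height `-i - 1`, the highest integer height at which it is present.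
  refine ⟨⟨fun i => (x (-i - 1 : ℤ)).digit i, min l 0, fun i hi => ?_⟩,
    fun t => ofMAdic_eq_ofMAdic fun i hi => h2 _ _ i hi ?_⟩
  · rw [h2 _ 0 i ?_ ?_, hl i (hi.trans_le (min_le_left _ _))]
    · rw [Int.floor_intCast]; omega
    · rw [Int.floor_zero]; exact hi.trans_le (min_le_right _ _)
  · rw [Int.floor_intCast]; omega

end TreePoint

variable {E : Type*} [NormedAddCommGroup E] [NormedSpace ℝ E] [FiniteDimensional ℝ E]
  {N : Type*} [TopologicalSpace N] [T2Space N] [ChartedSpace E N] [Group N]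
  [LieGroup 𝓘(ℝ, E) ∞ N]
  {φ : Multiplicative ℝ →* MulAut N}
  {ip : InnerProductSpace.Core ℝ (GroupLieAlgebra 𝓘(ℝ, E) N)}
  {m : ℕ} [NeZero m]

theorem eq_of_edist_vertical_le (hφ : IsSmoothFlow E φ) {g g' : N} {s t : ℝ}
    (h : edist (Heintze.vertical (φ := φ) ip g s) (Heintze.vertical ip g' t) ≤ edist s t) :
    g = g' := by
  rw [edist_vertical_eq hφ, edist_comm s t, edist_dist, Real.dist_eq] at h
  have h1 := eq_one_of_edist_le hφ ip h
  rw [MulEquiv.map_eq_one_iff] at h1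
  exact inv_mul_eq_one.1 h1

namespace Space

/-- Each component moves at least as far as the height, while the squares add up to at most twice
the square of the height difference; so neither can exceed it. -/
theorem edist_fst_le_and_edist_snd_le (hφ : IsSmoothFlow E φ) {p q : Space φ ip m}
    (h : edist p q ≤ edist p.height q.height) :
    edist p.fst q.fst ≤ edist p.height q.height ∧
      edist p.snd q.snd ≤ edist p.height q.height := by
  have h₁ : edist p.height q.height ≤ edist p.fst q.fst := Millefeuille.edist_height_le hφ _ _
  have h₂ := TreePoint.edist_height_le p.snd q.snd
  rw [snd_height, snd_height] at h₂
  have hsq := (edist_sq_add_le p q).trans (mul_le_mul_right (pow_le_pow_left' h 2) 2)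
  rw [two_mul] at hsq
  have htop : edist p.height q.height ^ 2 ≠ ⊤ := ENNReal.pow_ne_top (edist_ne_top _ _)
  constructor
  · refine le_of_sq_le_sq ((ENNReal.add_le_add_iff_right htop).1 (le_trans ?_ hsq))
    gcongr
  · refine le_of_sq_le_sq ((ENNReal.add_le_add_iff_left htop).1 (le_trans ?_ hsq))
    gcongr

theorem exists_eq_vertical (hφ : IsSmoothFlow E φ) {γ : ℝ → Space φ ip m} (hγ : Isometry γ)
    (hh : ∀ t, (γ t).height = t) : ∃ ξ : N × MAdic m, γ = vertical ξ := by
  have h : ∀ s t, edist (γ s).fst (γ t).fst ≤ edist s t ∧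
      edist (γ s).snd (γ t).snd ≤ edist s t := by
    intro s t
    have := edist_fst_le_and_edist_snd_le hφ (p := γ s) (q := γ t) (by rw [hγ s t, hh, hh])
    rwa [hh, hh] at this
  have hfst : ∀ t, (γ t).fst = Heintze.vertical ip (γ t).fst.coords.1 t := by
    intro t
    have h1 : (γ t).fst = Heintze.vertical ip (γ t).fst.coords.1 (γ t).height := rfl
    rwa [hh] at h1
  have hsnd : ∀ t, (γ t).snd = TreePoint.ofMAdic (γ t).snd.toMAdic t := by
    intro t
    have h1 := (TreePoint.ofMAdic_toMAdic (γ t).snd).symm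
    rwa [snd_height, hh] at h1
  obtain ⟨y, hy⟩ := TreePoint.exists_eq_ofMAdic (fun t => (γ t).snd.toMAdic) fun s t => by
    have := (h s t).2
    rw [hsnd s, hsnd t, edist_dist, edist_dist, Real.dist_eq] at this
    exact (ENNReal.ofReal_le_ofReal_iff (abs_nonneg _)).1 this
  refine ⟨((γ 0).fst.coords.1, y), funext fun t => ?_⟩
  have hg : (γ t).fst.coords.1 = (γ 0).fst.coords.1 := by
    refine eq_of_edist_vertical_le (ip := ip) (s := t) (t := 0) hφ ?_
    rw [← hfst, ← hfst]
    exact (h t 0).1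
  have h1 := vertical_toMAdic (γ t)
  rw [hh] at h1
  rw [← h1, hg]
  simp only [vertical, hy t]

theorem exists_shadow_vertical (hφ : IsSmoothFlow E φ) (hexp : IsExpanding φ)
    (ip : InnerProductSpace.Core ℝ (GroupLieAlgebra 𝓘(ℝ, E) N)) (m : ℕ) [NeZero m] :
    ∃ S : ℝ≥0, 0 < S ∧ ∀ R : ℝ≥0, ∃ R' : ℝ≥0, ∀ p : ℤ → Space φ ip m,
      (∀ n : ℤ, edist (p n).height (n * S) ≤ R) → (∀ n, edist (p n) (p (n + 1)) ≤ R) →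
      ∃ ξ : N × MAdic m, ∀ n : ℤ, edist (vertical ξ (n * S)) (p n) ≤ R' := by
  obtain ⟨S, hS, hsh⟩ := Millefeuille.exists_shadow_vertical (φ := φ) ip hφ hexp
  lift S to ℝ≥0 using hS.le
  refine ⟨S, hS, fun R => ?_⟩
  -- From line `n` to line `n + 1` at height `n * S`: `R` to reach `p n`, `R` for the jump, `R + S`
  -- back from `p (n + 1)`; the `2` pays for projecting to the factors.
  set R₁ : ℝ≥0 := 2 * (3 * R + S) with hR₁
  obtain ⟨R₂, hR₂⟩ := hsh R₁
  -- `R₂` comes from `G_φ`, `2 * R₁` from the tree, and `R` from moving `p n` to height `n * S`.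
  refine ⟨R₂ + 2 * R₁ + R, fun p hp hpp => ?_⟩
  let η : ℤ → N × MAdic m := fun n => ((p n).fst.coords.1, (p n).snd.toMAdic)
  have hη : ∀ n, vertical (η n) (p n).height = p n := fun n => vertical_toMAdic (p n)
  have h1 : ∀ n (t : ℝ), edist (p n) (vertical (η n) t) = edist (p n).height t := by
    intro n t
    conv_lhs => rw [← hη n]
    exact edist_vertical hφ _ _ _
  have h2 : ∀ n : ℤ, 2 * edist (vertical (φ := φ) (ip := ip) (η n) (n * S))
      (vertical (η (n + 1)) (n * S)) ≤ R₁ := by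
    intro n
    have h3 := edist_triangle4 (vertical (φ := φ) (ip := ip) (η n) (n * S)) (p n) (p (n + 1))
      (vertical (η (n + 1)) (n * S))
    rw [edist_comm _ (p n), h1, h1] at h3
    have h4 : edist (p (n + 1)).height (n * S) ≤ R + S := by
      refine (edist_triangle _ (((n + 1 : ℤ) : ℝ) * S) _).trans (add_le_add (hp (n + 1)) ?_)
      rw [edist_dist, Real.dist_eq, show ((n + 1 : ℤ) : ℝ) * S - n * S = S by push_cast; ring,
        abs_of_pos hS, ENNReal.ofReal_coe_nnreal]
    rw [hR₁]
    push_cast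
    refine mul_le_mul_right (h3.trans ((add_le_add (add_le_add (hp n) (hpp n)) h4).trans ?_)) 2
    exact le_of_eq (by ring)
  obtain ⟨g, hg⟩ := hR₂ (fun n => (η n).1) fun n => (edist_fst_le _ _).trans (h2 n)
  obtain ⟨y, hy⟩ := TreePoint.exists_shadow_ofMAdic hS R₁ (fun n => (η n).2) fun n => by
    refine TreePoint.digit_eq_of_dist_le ?_ (t := n * S)
    have h5 := (edist_snd_le _ _).trans (h2 n)
    rw [edist_le_coe, ← NNReal.coe_le_coe, coe_nndist] at h5
    exact h5
  refine ⟨(g, y), fun n => (edist_triangle _ (vertical (η n) (n * S)) _).trans ?_⟩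
  rw [edist_comm _ (p n), h1]
  push_cast
  refine add_le_add ((edist_vertical_le_add hφ _ _ _).trans (add_le_add (hg n) ?_)) (hp n)
  have h6 := TreePoint.dist_ofMAdic_le_of_digit_eq R₁ (hy n)
  have h7 : edist (TreePoint.ofMAdic y (n * S)) (TreePoint.ofMAdic (η n).2 (n * S)) ≤
      ((2 * R₁ : ℝ≥0) : ℝ≥0∞) := by
    rw [edist_le_coe, ← NNReal.coe_le_coe, coe_nndist]
    exact_mod_cast h6
  rwa [ENNReal.coe_mul, ENNReal.coe_ofNat] at h7

end Space

end

/-! ### Height-respecting quasi-isometries and their boundary maps. -/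

noncomputable section

variable {E : Type*} [NormedAddCommGroup E] [NormedSpace ℝ E] [FiniteDimensional ℝ E]
  {N : Type*} [TopologicalSpace N] [T2Space N] [ChartedSpace E N] [Group N]
  [LieGroup 𝓘(ℝ, E) ∞ N]
  {φ : Multiplicative ℝ →* MulAut N}
  {ip : InnerProductSpace.Core ℝ (GroupLieAlgebra 𝓘(ℝ, E) N)}
  {m : ℕ} [NeZero m]

theorem exists_int_edist_mul_le {S : ℝ≥0} (hS : 0 < S) (t : ℝ) :
    ∃ n : ℤ, edist t (n * S) ≤ S := by
  refine ⟨⌊t / S⌋, ?_⟩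
  have hS' : (0 : ℝ) < S := hS
  have h1 := Int.floor_le (t / S)
  have h2 := Int.lt_floor_add_one (t / S)
  rw [le_div_iff₀ hS'] at h1
  rw [div_lt_iff₀ hS'] at h2
  rw [edist_dist, Real.dist_eq, abs_of_nonneg (by linarith), ← ENNReal.ofReal_coe_nnreal]
  exact ENNReal.ofReal_le_ofReal (by linarith)

theorem edist_mul_add_one_mul (S : ℝ≥0) (n : ℤ) :
    edist ((n : ℝ) * S) ((n + 1 : ℤ) * S) = S := by
  have hS : (0 : ℝ) ≤ S := S.2
  rw [edist_comm, edist_dist, Real.dist_eq,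
    show ((n + 1 : ℤ) : ℝ) * S - n * S = S by push_cast; ring, abs_of_nonneg hS,
    ENNReal.ofReal_coe_nnreal]

/-- A quasi-isometry with given constants which moves heights by a bounded amount. -/
structure IsCoarseMap (f : Space φ ip m → Space φ ip m) (K C H : ℝ≥0) : Prop where
  lower : ∀ x y, edist x y ≤ K * (edist (f x) (f y) + C)
  upper : ∀ x y, edist (f x) (f y) ≤ K * edist x y + C
  dense : ∀ z, ∃ x, edist (f x) z ≤ C
  height : ∀ x, edist (f x).height x.height ≤ H

theorem exists_isCoarseMap {f : Space φ ip m → Space φ ip m} (hf : IsQuasiIsometry f)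
    (hhr : IsHeightRespecting Space.height f) : ∃ K C H, IsCoarseMap f K C H := by
  obtain ⟨K, C, hK, h, hd⟩ := hf
  obtain ⟨-, a, c, hc⟩ := hhr
  -- The translation `a` is absorbed into the height bound, so images are compared with lines at the
  -- same height.
  refine ⟨K, C, Real.toNNReal (|a| + |c|), fun x y => ?_, fun x y => (h x y).2, hd,
    fun x => ?_⟩
  · have h1 := (h x y).1
    rwa [ENNReal.div_le_iff (by simpa using hK.ne') ENNReal.coe_ne_top, mul_comm] at h1
  · rw [edist_dist, Real.dist_eq]
    refine ENNReal.ofReal_le_ofReal (abs_le.2 ?_)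
    have h1 := hc x
    have := neg_abs_le a
    have := le_abs_self a
    have := le_abs_self c
    constructor <;> linarith [h1.1, h1.2]

namespace IsCoarseMap

variable {f : Space φ ip m → Space φ ip m} {K C H : ℝ≥0}

theorem exists_shadow (hf : IsCoarseMap f K C H) (hφ : IsSmoothFlow E φ) (hexp : IsExpanding φ) :
    ∃ B : ℝ≥0, ∀ ξ : N × MAdic m, ∃ η : N × MAdic m, ∀ t,
      edist (f (Space.vertical ξ t)) (Space.vertical η t) ≤ B := by
  obtain ⟨S, hS, h⟩ := Space.exists_shadow_vertical hφ hexp ip m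
  obtain ⟨R', hR'⟩ := h (max H (K * S + C))
  have hst : ∀ ξ (s t : ℝ), edist s t ≤ S → edist (f (Space.vertical ξ s))
      (f (Space.vertical ξ t)) ≤ (K * S + C : ℝ≥0) := by
    intro ξ s t hst
    refine (hf.upper _ _).trans ?_
    rw [Space.edist_vertical hφ, ENNReal.coe_add, ENNReal.coe_mul]
    gcongr
  refine ⟨K * S + C + R' + S, fun ξ => ?_⟩
  suffices hη : ∃ η, ∀ n : ℤ, edist (Space.vertical η (n * S)) (f (Space.vertical ξ (n * S))) ≤
      R' by
    obtain ⟨η, hη⟩ := hη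
    refine ⟨η, fun t => ?_⟩
    obtain ⟨n, hn⟩ := exists_int_edist_mul_le hS t
    refine (edist_triangle4 _ (f (Space.vertical ξ (n * S))) (Space.vertical η (n * S)) _).trans ?_
    rw [ENNReal.coe_add (K * S + C + R'), ENNReal.coe_add (K * S + C)]
    refine add_le_add (add_le_add (hst _ _ _ hn) ?_) ?_
    · rw [edist_comm]
      exact hη n
    · rwa [Space.edist_vertical hφ, edist_comm]
  refine hR' (fun n => f (Space.vertical ξ (n * S))) ?_ ?_
  · refine fun n => (hf.height (Space.vertical ξ (n * S))).trans ?_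
    exact ENNReal.coe_le_coe.2 (le_max_left _ _)
  · exact fun n => (hst ξ _ _ (edist_mul_add_one_mul S n).le).trans
      (ENNReal.coe_le_coe.2 (le_max_right _ _))

variable {B : ℝ≥0} {F : N × MAdic m → N × MAdic m}

/-- Pass through `f ξ_t` and `f η_t`. The additive constant is larger than needed so that the same
one serves in `edist_le_boundary`. -/
theorem edist_boundary_le (hf : IsCoarseMap f K C H)
    (hF : ∀ ξ t, edist (f (Space.vertical ξ t)) (Space.vertical (F ξ) t) ≤ B)
    (ξ η : N × MAdic m) (t : ℝ) :
    edist (Space.vertical (φ := φ) (ip := ip) (F ξ) t) (Space.vertical (F η) t) ≤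
      K * edist (Space.vertical (φ := φ) (ip := ip) ξ t) (Space.vertical η t) +
        ((1 + K) * (2 * B + C) : ℝ≥0) := by
  refine (edist_triangle4 _ (f (Space.vertical ξ t)) (f (Space.vertical η t)) _).trans ?_
  rw [edist_comm (Space.vertical (F ξ) t)]
  refine (add_le_add (add_le_add (hF ξ t) (hf.upper _ _)) (hF η t)).trans ?_
  push_cast
  calc _ = (K : ℝ≥0∞) * edist (Space.vertical (φ := φ) (ip := ip) ξ t) (Space.vertical η t) +
        1 * (2 * B + C) := by ring
    _ ≤ _ := by gcongr; exact le_self_add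

theorem edist_le_boundary (hf : IsCoarseMap f K C H)
    (hF : ∀ ξ t, edist (f (Space.vertical ξ t)) (Space.vertical (F ξ) t) ≤ B)
    (ξ η : N × MAdic m) (t : ℝ) :
    edist (Space.vertical (φ := φ) (ip := ip) ξ t) (Space.vertical η t) ≤
      K * edist (Space.vertical (φ := φ) (ip := ip) (F ξ) t) (Space.vertical (F η) t) +
        ((1 + K) * (2 * B + C) : ℝ≥0) := by
  have h1 := edist_triangle4 (f (Space.vertical ξ t)) (Space.vertical (F ξ) t)
    (Space.vertical (F η) t) (f (Space.vertical η t))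
  refine (hf.lower _ _).trans ?_
  push_cast
  calc _ ≤ (K : ℝ≥0∞) * (B + edist (Space.vertical (φ := φ) (ip := ip) (F ξ) t)
          (Space.vertical (F η) t) + B + C) := by
        gcongr
        exact h1.trans (add_le_add (add_le_add (hF ξ t) le_rfl)
          ((edist_comm _ _).trans_le (hF η t)))
    _ = K * edist (Space.vertical (φ := φ) (ip := ip) (F ξ) t) (Space.vertical (F η) t) +
        K * (2 * B + C) := by ring
    _ ≤ _ := by gcongr; exact le_add_self

theorem edist_height_preimage_le (hf : IsCoarseMap f K C H) (hφ : IsSmoothFlow E φ)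
    {p q : Space φ ip m} (h : edist (f p) q ≤ C) :
    edist p.height q.height ≤ (H + C : ℝ≥0) := by
  rw [ENNReal.coe_add]
  refine (edist_triangle _ (f p).height _).trans (add_le_add ?_ ?_)
  · rw [edist_comm]
    exact hf.height p
  · exact (Space.edist_height_le hφ _ _).trans h

theorem edist_preimage_le (hf : IsCoarseMap f K C H) {p p' q q' : Space φ ip m} {S : ℝ≥0}
    (h : edist (f p) q ≤ C) (h' : edist (f p') q' ≤ C) (hq : edist q q' ≤ S) :
    edist p p' ≤ (K * (C + S + C + C) : ℝ≥0) := by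
  have h1 : edist (f p) (f p') ≤ C + S + C :=
    (edist_triangle4 _ q q' _).trans
      (add_le_add (add_le_add h hq) ((edist_comm _ _).trans_le h'))
  refine (hf.lower _ _).trans ?_
  push_cast
  gcongr

theorem injective_boundary (hf : IsCoarseMap f K C H) (hφ : IsSmoothFlow E φ)
    (hexp : IsExpanding φ)
    (hF : ∀ ξ t, edist (f (Space.vertical ξ t)) (Space.vertical (F ξ) t) ≤ B) :
    Function.Injective F := by
  intro ξ η h
  refine (Space.isContractingFamily_vertical ip (m := m) hφ hexp).eq_of_bounded
    ((1 + K) * (2 * B + C)) fun t _ => ?_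
  have := hf.edist_le_boundary hF ξ η t
  rwa [h, edist_self, mul_zero, zero_add] at this

/-- Coarse preimages of points of `η` again have bounded jumps and heights near `n * S`, so a line
`ξ` shadows them; then `F ξ` stays at bounded distance from `η`, hence equals it. -/
theorem surjective_boundary (hf : IsCoarseMap f K C H) (hφ : IsSmoothFlow E φ)
    (hexp : IsExpanding φ)
    (hF : ∀ ξ t, edist (f (Space.vertical ξ t)) (Space.vertical (F ξ) t) ≤ B) :
    Function.Surjective F := by
  intro η
  obtain ⟨S, hS, h⟩ := Space.exists_shadow_vertical hφ hexp ip m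
  obtain ⟨R', hR'⟩ := h (max (H + C) (K * (C + S + C + C)))
  choose x hx using fun n : ℤ => hf.dense (Space.vertical η (n * S))
  obtain ⟨ξ, hξ⟩ := hR' x
    (fun n => (hf.edist_height_preimage_le hφ (hx n)).trans
      (ENNReal.coe_le_coe.2 (le_max_left _ _)))
    (fun n => (hf.edist_preimage_le (hx n) (hx (n + 1))
      ((Space.edist_vertical hφ _ _ _).trans (edist_mul_add_one_mul S n)).le).trans
      (ENNReal.coe_le_coe.2 (le_max_right _ _)))
  refine ⟨ξ, (Space.isContractingFamily_vertical ip (m := m) hφ hexp).eq_of_bounded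
    (S + (B + (K * R' + C) + C) + S) fun t _ => ?_⟩
  obtain ⟨n, hn⟩ := exists_int_edist_mul_le hS t
  refine (edist_triangle4 _ (Space.vertical (F ξ) (n * S)) (Space.vertical η (n * S)) _).trans ?_
  rw [Space.edist_vertical hφ, Space.edist_vertical hφ, edist_comm (_ * _) t]
  push_cast
  refine add_le_add (add_le_add hn ?_) hn
  refine (edist_triangle4 _ (f (Space.vertical ξ (n * S))) (f (x n)) _).trans ?_
  rw [edist_comm (Space.vertical (F ξ) (n * S))]
  refine add_le_add (add_le_add (hF _ _) ((hf.upper _ _).trans ?_)) (hx n)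
  gcongr
  exact hξ n

theorem bijective_boundary (hf : IsCoarseMap f K C H) (hφ : IsSmoothFlow E φ)
    (hexp : IsExpanding φ)
    (hF : ∀ ξ t, edist (f (Space.vertical ξ t)) (Space.vertical (F ξ) t) ≤ B) :
    Function.Bijective F :=
  ⟨hf.injective_boundary hφ hexp hF, hf.surjective_boundary hφ hexp hF⟩

end IsCoarseMap

variable (φ ip m) in
-- At distance `1` in `X` both components are at distance at most `2`, which bounds both metrics
-- from above; and either the `G_φ` components are at distance at least `1 / 2` or the tree
-- components differ, which bounds one metric from below.
theorem exists_distProd_bounds (hφ : IsSmoothFlow E φ) (hexp : IsExpanding φ) (hm : 2 ≤ m) :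
    ∃ T : ℝ, ∀ (ξ η : N × MAdic m) t, ξ ≠ η →
      edist (Space.vertical (φ := φ) (ip := ip) ξ t) (Space.vertical η t) = 1 →
      (m : ℝ) ^ (t - T) ≤ distProd φ ip ξ η ∧ distProd φ ip ξ η ≤ (m : ℝ) ^ (t + T) := by
  have hm1 : (1 : ℝ) < m := by exact_mod_cast one_lt_two.trans_le hm
  have hG := isContractingFamily_vertical ip hφ hexp
  obtain ⟨T₁, h₁, h₁'⟩ := hG.exists_parabolicDist_le 2
  obtain ⟨T₂, h₂, h₂'⟩ := hG.exists_le_parabolicDist (ENNReal.half_pos one_ne_zero)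
  refine ⟨max (max T₁ T₂) 2, fun ξ η t hne h => ⟨?_, ?_⟩⟩
  · have hadd := Space.edist_vertical_le_add (ip := ip) hφ ξ η t
    rw [h] at hadd
    by_cases hT : 1 / 2 ≤ edist (Heintze.vertical (φ := φ) ip ξ.1 t) (Heintze.vertical ip η.1 t)
    · have hne1 : ξ.1 ≠ η.1 := by
        intro heq
        rw [heq, edist_self] at hT
        exact (ENNReal.half_pos one_ne_zero).not_ge hT
      refine le_max_of_le_left (le_trans ?_ (h₂' m hm1 _ _ t hT hne1))
      refine Real.rpow_le_rpow_of_exponent_le hm1.le ?_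
      linarith [le_max_right T₁ T₂, le_max_left (max T₁ T₂) 2]
    · have hne2 : TreePoint.ofMAdic ξ.2 t ≠ TreePoint.ofMAdic η.2 t := by
        intro heq
        rw [heq, edist_self, add_zero] at hadd
        exact hT (ENNReal.half_le_self.trans hadd)
      refine le_max_of_le_right (le_trans ?_ (MAdic.le_dist hm hne2))
      refine Real.rpow_le_rpow_of_exponent_le hm1.le ?_
      linarith [le_max_right (max T₁ T₂) 2]
  · have hfst := Space.edist_fst_le (Space.vertical (φ := φ) (ip := ip) ξ t) (Space.vertical η t)
    have hsnd := Space.edist_snd_le (Space.vertical (φ := φ) (ip := ip) ξ t) (Space.vertical η t)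
    rw [h, mul_one] at hfst hsnd
    refine max_le ((h₁' m hm1 _ _ t hfst).trans ?_) ((MAdic.dist_le (R := 2) (t := t) hm ?_).trans ?_)
    · refine Real.rpow_le_rpow_of_exponent_le hm1.le ?_
      linarith [le_max_left T₁ T₂, le_max_left (max T₁ T₂) 2]
    · have h3 : edist (TreePoint.ofMAdic ξ.2 t) (TreePoint.ofMAdic η.2 t) ≤
          ((2 : ℝ≥0) : ℝ≥0∞) := hsnd
      rw [edist_le_coe, ← NNReal.coe_le_coe, coe_nndist] at h3
      exact h3
    · refine Real.rpow_le_rpow_of_exponent_le hm1.le ?_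
      linarith [le_max_right (max T₁ T₂) 2]

theorem distProd_self (φ : Multiplicative ℝ →* MulAut N)
    (ip : InnerProductSpace.Core ℝ (GroupLieAlgebra 𝓘(ℝ, E) N)) (hm : 2 ≤ m)
    (ξ : N × MAdic m) : distProd φ ip ξ ξ = 0 := by
  rw [distProd, distN, parabolicDist_self, MAdic.dist_self hm, max_self]

variable (ip m) in
/-- The vertical geodesics of `X_{N,φ,m}` are parametrized by `N × ℚ_m`. -/
def boundaryEquiv (hφ : IsSmoothFlow E φ) (hexp : IsExpanding φ) :
    N × MAdic m ≃ Boundary φ ip m :=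
  Equiv.ofBijective
    (fun ξ => ⟨Space.vertical ξ, fun s t => Space.edist_vertical hφ ξ s t, fun _ => rfl⟩) <| by
    constructor
    · intro ξ η h
      have h1 : Space.vertical (φ := φ) (ip := ip) ξ = Space.vertical η :=
        congrArg Boundary.line h
      exact (Space.isContractingFamily_vertical ip hφ hexp).separated ξ η fun t => by
        rw [h1, edist_self]
    · rintro ⟨γ, hγ, hh⟩
      obtain ⟨ξ, rfl⟩ := Space.exists_eq_vertical hφ hγ hh
      exact ⟨ξ, rfl⟩

theorem induces_of_edist_le {f : Space φ ip m → Space φ ip m}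
    {F : Boundary φ ip m → Boundary φ ip m} (B : ℝ≥0)
    (hF : ∀ ξ t, edist (f (ξ.line t)) ((F ξ).line t) ≤ B) : Induces f F := by
  have h : ∀ (ξ : Boundary φ ip m) (I : Set ℝ),
      Metric.hausdorffEDist (f '' (ξ.line '' I)) ((F ξ).line '' I) ≠ ⊤ := by
    intro ξ I
    refine ne_top_of_le_ne_top ENNReal.coe_ne_top
      (Metric.hausdorffEDist_le_of_mem_edist (r := B) ?_ ?_)
    · rintro _ ⟨_, ⟨t, ht, rfl⟩, rfl⟩
      exact ⟨_, ⟨t, ht, rfl⟩, hF ξ t⟩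
    · rintro _ ⟨t, ht, rfl⟩
      refine ⟨_, ⟨_, ⟨t, ht, rfl⟩, rfl⟩, ?_⟩
      rw [edist_comm]
      exact hF ξ t
  exact fun ξ => ⟨h ξ _, h ξ _⟩

/-- The downward rays decide: those of `F ξ` and `F' ξ` are at finite Hausdorff distance, and since
the height is `1`-Lipschitz, nearby points may be taken at equal heights at the cost of doubling the
bound. -/
theorem Induces.unique (hφ : IsSmoothFlow E φ) (hexp : IsExpanding φ)
    {f : Space φ ip m → Space φ ip m} {F F' : Boundary φ ip m → Boundary φ ip m}
    (h : Induces f F) (h' : Induces f F') : F' = F := by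
  funext ξ
  obtain ⟨η, hη⟩ := (boundaryEquiv ip m hφ hexp).surjective (F ξ)
  obtain ⟨η', hη'⟩ := (boundaryEquiv ip m hφ hexp).surjective (F' ξ)
  rw [← hη, ← hη']
  congr 1
  have hfin : Metric.hausdorffEDist ((F' ξ).line '' Iic 0) ((F ξ).line '' Iic 0) ≠ ⊤ := by
    refine ne_top_of_le_ne_top ?_ (Metric.hausdorffEDist_triangle (t := f '' (ξ.line '' Iic 0)))
    refine ENNReal.add_ne_top.2 ⟨?_, (h ξ).1⟩
    rw [Metric.hausdorffEDist_comm]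
    exact (h' ξ).1
  lift Metric.hausdorffEDist ((F' ξ).line '' Iic 0) ((F ξ).line '' Iic 0) to ℝ≥0 using hfin
    with R hR
  refine (Space.isContractingFamily_vertical ip hφ hexp).eq_of_bounded (2 * (R + 1)) fun t ht => ?_
  have hlt : Metric.hausdorffEDist ((F' ξ).line '' Iic 0) ((F ξ).line '' Iic 0) <
      ((R + 1 : ℝ≥0) : ℝ≥0∞) := by
    rw [← hR]
    exact_mod_cast lt_add_one R
  rw [← hη, ← hη'] at hlt
  obtain ⟨_, ⟨s, hs, rfl⟩, hst⟩ := Metric.exists_edist_lt_of_hausdorffEDist_lt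
    (mem_image_of_mem _ (show t ∈ Iic (0 : ℝ) from ht)) hlt
  have hst' : edist (Space.vertical (φ := φ) (ip := ip) η' t) (Space.vertical η s) ≤
    ((R + 1 : ℝ≥0) : ℝ≥0∞) := hst.le
  have hts : edist t s ≤ ((R + 1 : ℝ≥0) : ℝ≥0∞) :=
    (Space.edist_height_le hφ (Space.vertical (φ := φ) (ip := ip) η' t)
      (Space.vertical η s)).trans hst'
  refine (edist_triangle _ (Space.vertical η s) _).trans ?_
  rw [two_mul, ENNReal.coe_add (R + 1)]
  refine add_le_add hst' ?_
  rwa [Space.edist_vertical hφ, edist_comm]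

end

end Millefeuille

theorem mainTheorem9
    {E : Type*} [NormedAddCommGroup E] [NormedSpace ℝ E] [FiniteDimensional ℝ E]
    {N : Type*} [TopologicalSpace N] [T2Space N] [ChartedSpace E N] [Group N]
    [LieGroup 𝓘(ℝ, E) ∞ N] [SimplyConnectedSpace N] [Group.IsNilpotent N]
    (φ : Multiplicative ℝ →* MulAut N)
    (hφ : Millefeuille.IsSmoothFlow E φ) (hexp : Millefeuille.IsExpanding φ)
    (ip : InnerProductSpace.Core ℝ (GroupLieAlgebra 𝓘(ℝ, E) N))
    (m : ℕ) [NeZero m] (hm : 2 ≤ m)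
    (f : Millefeuille.Space φ ip m → Millefeuille.Space φ ip m)
    (hf : Millefeuille.IsQuasiIsometry f)
    (hhr : Millefeuille.IsHeightRespecting Millefeuille.Space.height f) :
    ∃ (e : N × Millefeuille.MAdic m ≃ Millefeuille.Boundary φ ip m)
      (F : Millefeuille.Boundary φ ip m ≃ Millefeuille.Boundary φ ip m),
      (∀ ξ, (e ξ).line = Millefeuille.Space.vertical ξ) ∧
      Millefeuille.Induces f F ∧
      (∀ F' : Millefeuille.Boundary φ ip m → Millefeuille.Boundary φ ip m,
        Millefeuille.Induces f F' → F' = F) ∧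
      Millefeuille.IsBilipschitz Millefeuille.Boundary.dist F ∧
      Millefeuille.IsBilipschitz (Millefeuille.distProd φ ip) (fun ξ => e.symm (F (e ξ))) := by
  open Millefeuille in
  obtain ⟨K, C, H, hc⟩ := exists_isCoarseMap hf hhr
  obtain ⟨B, hB⟩ := hc.exists_shadow hφ hexp
  choose F₀ hF₀ using hB
  have hX := Space.isContractingFamily_vertical ip (m := m) hφ hexp
  let e := boundaryEquiv ip m hφ hexp
  let G : N × MAdic m ≃ N × MAdic m := Equiv.ofBijective F₀ (hc.bijective_boundary hφ hexp hF₀)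
  -- The shadowing map `F₀` lives on `N × ℚ_m`, and `F` is its conjugate by the parametrization `e`;
  -- both bilipschitz claims thereby become claims about `F₀`.
  let F : Boundary φ ip m ≃ Boundary φ ip m := (e.symm.trans G).trans e
  have hFe : ∀ ξ, F (e ξ) = e (F₀ ξ) := fun ξ => by simp [F, G]
  have hind : Induces f F := induces_of_edist_le B fun ξ t => by
    obtain ⟨ξ, rfl⟩ := e.surjective ξ
    rw [hFe]
    exact hF₀ ξ t
  refine ⟨e, F, fun _ => rfl, hind, fun F' hF' => hind.unique hφ hexp hF', ?_, ?_⟩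
  · obtain ⟨T₁, h₁, h₁'⟩ := hX.exists_parabolicDist_le 1
    obtain ⟨T₂, h₂, h₂'⟩ := hX.exists_le_parabolicDist one_pos
    have he1 : 1 < Real.exp 1 := Real.one_lt_exp_iff.2 one_pos
    obtain ⟨a, b, ha, hb, hab⟩ := hX.isBilipschitz (hc.edist_boundary_le hF₀)
      (hc.edist_le_boundary hF₀)
      (D := fun ξ η => parabolicDist (Real.exp 1) (Space.vertical (φ := φ) (ip := ip) ξ)
        (Space.vertical η)) (T := max T₁ T₂) he1 (fun ξ => parabolicDist_self _ _)
      fun ξ η t hne ht => ⟨(Real.rpow_le_rpow_of_exponent_le he1.le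
        (by linarith [le_max_right T₁ T₂])).trans (h₂' _ he1 ξ η t ht.ge hne),
        (h₁' _ he1 ξ η t (by rw [ht]; rfl)).trans (Real.rpow_le_rpow_of_exponent_le he1.le
        (by linarith [le_max_left T₁ T₂]))⟩
    refine ⟨a, b, ha, hb, fun ξ η => ?_⟩
    obtain ⟨ξ, rfl⟩ := e.surjective ξ
    obtain ⟨η, rfl⟩ := e.surjective η
    rw [hFe, hFe]
    exact hab ξ η
  · obtain ⟨T, hT⟩ := exists_distProd_bounds φ ip m hφ hexp hm
    have hm1 : (1 : ℝ) < m := by exact_mod_cast one_lt_two.trans_le hm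
    have hFF : (fun ξ => e.symm (F (e ξ))) = F₀ := by
      funext ξ
      rw [hFe, Equiv.symm_apply_apply]
    rw [hFF]
    exact hX.isBilipschitz (hc.edist_boundary_le hF₀) (hc.edist_le_boundary hF₀) hm1
      (distProd_self φ ip hm) hT
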